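/- Let $\mathbb B$ be a separable real Banach space ordered by a closed convex cone $\mathcal K$ ($\mathcal K\cap(-\mathcal K)=\{0\}$) with nonempty interior. Write $x\le y$ if $y-x\in\mathcal K$, $x<y$ if $x\le y$ and $x\neq y$, and $x\ll y$ if $y-x\in\operatorname{Int}\mathcal K$. Let $X\subseteq\mathbb B$ be a Borel set that is p-convex ($x,y\in X$, $x<y$, $0<t<1$ imply $tx+(1-t)y\in X$), and let $\Phi:[0,\infty)\times X\to X$ be a continuous semiflow that is strongly order preserving: $x\le y$ implies $\Phi_t(x)\le\Phi_t(y)$ for all $t\ge 0$, and whenever $x<y$ in $X$ there are relatively open sets $U\ni x$, $W\ni y$ in $X$ and $t\ge0$ with $\Phi_t(u)\le\Phi_t(w)$ for all $u\in U$, $w\in W$. Let $t_0\ge 0$ and suppose that for every $t\ge t_0$ the map $\Phi_t$ is compact (it maps bounded sets to relatively compact sets) and continuously Fréchet differentiable on $X$ (relative to $X$) with compact derivatives $\Phi_t'(x)$. An equilibrium is a point $e\in X$ with $\Phi_t(e)=e$ for all $t\ge 0$. It is irreducible if for some $t>0$ with $t\ge t_0$ the operator $\Phi_t'(e)$ is strongly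 positive, i.e. $x>0$ implies $\Phi_t'(e)x\gg0$. With $\rho$ denoting the spectral radius, $e$ is linearly stable if $\rho(\Phi_t'(e))<1$ for all $t>0$ with $t\ge t_0$, and neutrally stable if $\rho(\Phi_t'(e))=1$ for all $t>0$ with $t\ge t_0$. Suppose in addition that (i) every orbit $\{\Phi_t(x):t\ge 0\}$, $x\in X$, has compact closure in $X$; (ii) $X$ is order convex ($x,y\in X$ and $x\le z\le y$ imply $z\in X$); (iii) every equilibrium is irreducible; (iv) $\Phi$ is eventually strongly monotone: it is monotone and there is $t_1\ge 0$ such that $x<y$ implies $\Phi_t(x)\ll\Phi_t(y)$ for all $t\ge t_1$. Let $C_s$ be the set of $x\in X$ whose omega limit set is $\{e\}$ for some linearly stable or neutrally stable equilibrium $e$. Then $C_s$ is prevalent in $X$; that is, $X\setminus C_s$ is shy: it is contained in a Borel set $S\subseteq\mathbb B$ for which there is a nonzero finite compactly supported Borel measure $\mu$ on $\mathbb B$ with $\mu(S+x)=0$ for every $x\in\mathbb B$. -/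

import Mathlib

open Set Filter Topology MeasureTheory
open scoped NNReal ENNReal

namespace MonotoneSemiflow

noncomputable section

/-! ### Shy and prevalent sets -/

section Prevalence

variable {V : Type*} [NormedAddCommGroup V] [MeasurableSpace V]

/-- `W` is shy: it is contained in a Borel set `S` such that some nontrivial (finite) Borel measure
with compact support gives measure zero to every translate `S + x`. -/
def IsShy (W : Set V) : Prop :=
  ∃ S : Set V, W ⊆ S ∧ MeasurableSet S ∧
    ∃ μ : Measure V, IsFiniteMeasure μ ∧ μ ≠ 0 ∧
      (∃ J : Set V, IsCompact J ∧ μ Jᶜ = 0) ∧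
      ∀ x : V, μ ((fun w => w + x) '' S) = 0

/-- `W` is prevalent in `A`: the set `A \ W` is shy. -/
def IsPrevalentIn (W A : Set V) : Prop :=
  IsShy (A \ W)

end Prevalence

/-! ### Spectral radius -/

/-- The spectral radius `lim ‖a ^ n‖ ^ (1 / n)` of an element of a normed ring. For a bounded
operator on a real Banach space this is the spectral radius of its complexification (the
supremum over the real spectrum alone would be too small). -/
def specRadius {R : Type*} [NormedRing R] (a : R) : ℝ≥0∞ :=
  limsup (fun n : ℕ => (‖a ^ n‖₊ : ℝ≥0∞) ^ (1 / n : ℝ)) atTop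

/-- In a complex Banach algebra, `specRadius` is the supremum of the moduli of the spectrum. -/
theorem specRadius_eq_spectralRadius {R : Type*} [NormedRing R] [NormedAlgebra ℂ R]
    [CompleteSpace R] (a : R) : specRadius a = spectralRadius ℂ a :=
  (spectrum.pow_nnnorm_pow_one_div_tendsto_nhds_spectralRadius a).limsup_eq

/-! ### Order notions

The order cone of an ordered Banach space `V` is `Set.Ici (0 : V) = {x | 0 ≤ x}`. -/

section Order

variable {V : Type*} [NormedAddCommGroup V] [NormedSpace ℝ V] [PartialOrder V]

/-- The strong ordering `x ≪ y`: `y - x` lies in the interior of the order cone. -/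
def StronglyLT (x y : V) : Prop :=
  y - x ∈ interior (Ici (0 : V))

/-- `A` contains the segment between any two of its points `x < y`. -/
def IsPConvex (A : Set V) : Prop :=
  ∀ x ∈ A, ∀ y ∈ A, x < y → ∀ t : ℝ, 0 < t → t < 1 → t • x + (1 - t) • y ∈ A

/-- A bounded operator `A` is strongly positive: `x > 0` implies `A x ≫ 0`. -/
def IsStronglyPositive (A : V →L[ℝ] V) : Prop :=
  ∀ x : V, 0 < x → StronglyLT 0 (A x)

end Order

/-! ### Semiflows

A semiflow on `X ⊆ V` is a Mathlib `Flow ℝ≥0 X`: a jointly continuous action of the additive monoid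
`[0, ∞)` on the subspace `X`. -/

section Semiflow

variable {V : Type*} [NormedAddCommGroup V] {X : Set V} (Φ : Flow ℝ≥0 X)

/-- The set `E` of equilibria. -/
def equilibria : Set X :=
  {e | Φ.orbit e = {e}}

/-- The omega limit set of a point, as a subset of `X`. -/
def omegaSet (x : X) : Set X :=
  omegaLimit atTop Φ {x}

/-- The orbit of `x` is precompact: its closure in `X` is compact. -/
def HasPrecompactOrbit (x : X) : Prop :=
  IsCompact (closure (Φ.orbit x))

/-- The semiflow is monotone. -/
def IsMonotone [PartialOrder V] : Prop :=
  ∀ t : ℝ≥0, ∀ x y : X, x ≤ y → Φ t x ≤ Φ t y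

/-- The semiflow is strongly order preserving. -/
def IsSOP [PartialOrder V] : Prop :=
  IsMonotone Φ ∧ ∀ x y : X, x < y →
    ∃ U W : Set X, IsOpen U ∧ IsOpen W ∧ x ∈ U ∧ y ∈ W ∧
      ∃ t : ℝ≥0, ∀ u ∈ U, ∀ w ∈ W, Φ t u ≤ Φ t w

/-- The semiflow is eventually strongly monotone. -/
def IsEventuallyStronglyMonotone [PartialOrder V] : Prop :=
  IsMonotone Φ ∧ ∃ t₁ : ℝ≥0, ∀ x y : X, x < y →
    ∀ t : ℝ≥0, t₁ ≤ t → StronglyLT (Φ t x : V) (Φ t y : V)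

/-- The time-`t` map of the semiflow as a map on `V`, extended by the junk value `0` off `X`. -/
def timeMap (t : ℝ≥0) : V → V :=
  Function.extend ((↑) : X → V) (fun y => (Φ t y : V)) 0

theorem timeMap_coe (t : ℝ≥0) (x : X) : timeMap Φ t (x : V) = (Φ t x : V) :=
  Subtype.val_injective.extend_apply _ _ x

/-- The time-`t` map is compact: it maps bounded sets to relatively compact sets. -/
def IsCompactTimeMap (t : ℝ≥0) : Prop :=
  ∀ S : Set X, Bornology.IsBounded ((↑) '' S : Set V) →
    IsCompact (closure ((fun y : X => (Φ t y : V)) '' S))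

variable [NormedSpace ℝ V]

/-- For all `t ≥ t₀` the time-`t` map is compact and continuously Frechet differentiable on `X`,
with compact derivative `D t x` at `x` (written `Φ_t'(x)`; if `X` is not open, differentiability is
relative to `X`). -/
structure IsCompactC1From (t₀ : ℝ≥0) (D : ℝ≥0 → X → V →L[ℝ] V) : Prop where
  compact_map : ∀ t, t₀ ≤ t → IsCompactTimeMap Φ t
  hasFDeriv : ∀ t, t₀ ≤ t → ∀ x : X, HasFDerivWithinAt (timeMap Φ t) (D t x) X (x : V)
  continuous_deriv : ∀ t, t₀ ≤ t → Continuous (D t)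
  compact_deriv : ∀ t, t₀ ≤ t → ∀ x : X, IsCompactOperator (D t x)

/-- The equilibrium `e` is irreducible: `Φ_t'(e)` is strongly positive for some `t > 0` (among the
times `t ≥ t₀`, at which the derivative is available). -/
def IsIrreducibleAt [PartialOrder V] (t₀ : ℝ≥0) (D : ℝ≥0 → X → V →L[ℝ] V) (e : X) : Prop :=
  ∃ t : ℝ≥0, 0 < t ∧ t₀ ≤ t ∧ IsStronglyPositive (D t e)

/-- Linear stability of `e`: the spectral radius of `Φ_t'(e)` is `< 1` for all `t > 0`, `t ≥ t₀`. -/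
def IsLinearlyStableAt (t₀ : ℝ≥0) (D : ℝ≥0 → X → V →L[ℝ] V) (e : X) : Prop :=
  ∀ t : ℝ≥0, 0 < t → t₀ ≤ t → specRadius (D t e) < 1

/-- Neutral stability of `e`: the spectral radius of `Φ_t'(e)` is `1` for all `t > 0`, `t ≥ t₀`. -/
def IsNeutrallyStableAt (t₀ : ℝ≥0) (D : ℝ≥0 → X → V →L[ℝ] V) (e : X) : Prop :=
  ∀ t : ℝ≥0, 0 < t → t₀ ≤ t → specRadius (D t e) = 1

/-- The set `E_s` of linearly stable or neutrally stable equilibria. -/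
def stableEquilibria (t₀ : ℝ≥0) (D : ℝ≥0 → X → V →L[ℝ] V) : Set X :=
  {e | e ∈ equilibria Φ ∧ (IsLinearlyStableAt t₀ D e ∨ IsNeutrallyStableAt t₀ D e)}

/-- The set `C_s` of points whose omega limit set is `{e}` for some `e ∈ E_s`. -/
def stablyConvergent (t₀ : ℝ≥0) (D : ℝ≥0 → X → V →L[ℝ] V) : Set X :=
  {x | ∃ e ∈ stableEquilibria Φ t₀ D, omegaSet Φ x = {e}}

end Semiflow

end

end MonotoneSemiflow

open MonotoneSemiflow

/-!
Fix a vector `v` in the interior of the cone and test shyness with Lebesgue measure on the segment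
from `0` to `v` (`isShy_of_countable_lines`). It is enough to find a Borel set of stably convergent
points, `goodSet Φ v`, whose complement in `X` meets every line in direction `v` in a countable set.

Countability comes from one principle: in a second countable space, all but countably many members
of a family indexed by reals are accumulated by members of larger index
(`countable_setOf_right_isolated`). It is applied twice on each line.

* To nonconvergent points. If `x < y` and the orbit of `x` does not converge, then `ω(x) ≤ ω(y)`
  (`omegaSet_le_of_not_convergent`). A limit point of `x` accumulated by limit points of larger
  points of the line is therefore the largest element of `ω(x)`. As omega limit sets are unordered
  (`not_lt_of_mem_omegaSet`), `ω(x)` is a singleton, a contradiction.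
* To convergent points. Off a countable set, either a larger point of the line has the same limit,
  or the limit is approached by larger equilibria (`countable_line_not_good`).

In both cases for convergent points the limit `e` is stable (`goodSet_subset`). If `e` attracts two
ordered points, no `Φ_t'(e)` can have spectral radius above `1`: otherwise `v ≪ Φ_T'(e) v` for some
`T`, and the gap between the two ordered orbits could not close (`false_of_expanding`,
`mem_stableEquilibria_of_tendsto`). If `e` is approached by larger equilibria, the limiting
direction of approach is a positive fixed vector of all the derivatives, and their spectral radius
is `1` (`mem_stableEquilibria_of_accumulation`).

The relation `ω(x) ≤ ω(y)` for `x < y` is one alternative of the limit set dichotomy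
(`omegaSet_le_of_not_subset`). In the other one the two orbits are asymptotic and `ω(x)` consists of
equilibria (`exists_tendsto_of_subset`). If `ω(x)` is not a singleton, it has no isolated points, so
at each `e ∈ ω(x)` it has a tangent direction, which is fixed by a strongly positive derivative
`Φ_τ'(e)`. As `ω(x)` is unordered, this direction is not comparable to `0`, so the spectral radius
of `Φ_τ'(e)` exceeds `1` and `false_of_expanding` excludes the alternative.

The spectral facts are obtained without the Krein–Rutman theorem and without complexification: a
compact operator of spectral radius above `1` has a backward orbit that decays exponentially
(`exists_backward_orbit_of_one_lt_specRadius`). Comparing it with order units gives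
`specRadius_le_one_of_apply_eq` and the growth estimate `exists_smul_le_pow_apply`, while resolvent
vectors give `one_lt_specRadius_of_apply_eq`.

Every equilibrium at which derivatives are composed is a limit of interior points of `X`, by order
convexity; there the chain rule and positivity hold although derivatives relative to `X` need not be
unique at the boundary (`mem_closure_interior`, `deriv_add`, `apply_nonneg`).
-/

open MonotoneSemiflow

namespace MonotoneSemiflow

/-! ### The strong ordering -/

section StrongOrder

variable {V : Type*} [NormedAddCommGroup V] [PartialOrder V]

theorem isOpen_setOf_stronglyLT : IsOpen {p : V × V | StronglyLT p.1 p.2} :=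
  isOpen_interior.preimage (continuous_snd.sub continuous_fst)

theorem eventually_stronglyLT {ι : Type*} {l : Filter ι} {f g : ι → V} {a b : V}
    (hf : Tendsto f l (𝓝 a)) (hg : Tendsto g l (𝓝 b)) (h : StronglyLT a b) :
    ∀ᶠ i in l, StronglyLT (f i) (g i) :=
  (hf.prodMk_nhds hg).eventually (isOpen_setOf_stronglyLT.mem_nhds h)

theorem StronglyLT.smul [NormedSpace ℝ V] [IsOrderedModule ℝ V] {v : V} (h : StronglyLT 0 v) {c : ℝ}
    (hc : 0 < c) : StronglyLT 0 (c • v) := by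
  have hopen : IsOpen {x : V | c⁻¹ • x ∈ interior (Ici (0 : V))} :=
    isOpen_interior.preimage (continuous_id.const_smul _)
  refine mem_interior.2 ⟨_, fun x hx => ?_, hopen, ?_⟩
  · have h1 : (0 : V) ≤ c⁻¹ • x := interior_subset hx
    have := smul_nonneg hc.le h1
    rwa [smul_inv_smul₀ hc.ne'] at this
  · simpa [StronglyLT, inv_smul_smul₀ hc.ne'] using h

variable [IsOrderedAddMonoid V]

theorem StronglyLT.le {a b : V} (h : StronglyLT a b) : a ≤ b :=
  sub_nonneg.1 (interior_subset h)

theorem StronglyLT.trans_le {a b c : V} (h : StronglyLT a b) (h' : b ≤ c) : StronglyLT a c := by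
  have hopen : IsOpen {x : V | x - (c - b) ∈ interior (Ici (0 : V))} :=
    isOpen_interior.preimage (continuous_id.sub continuous_const)
  refine mem_interior.2 ⟨_, fun x hx => ?_, hopen, ?_⟩
  · have h1 : (0 : V) ≤ x - (c - b) := interior_subset hx
    exact (sub_nonneg.2 h').trans (sub_nonneg.1 h1)
  · have h1 : c - a - (c - b) = b - a := by abel
    rw [mem_ofPred_eq, h1]
    exact h

variable [NormedSpace ℝ V]

/-- A strongly positive vector dominates a positive multiple of any given vector. -/
theorem StronglyLT.exists_smul_le {a : V} (h : StronglyLT 0 a) (v : V) :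
    ∃ ε : ℝ, 0 < ε ∧ ε • v ≤ a := by
  have h1 : Tendsto (fun ε : ℝ => ε • v) (𝓝[>] 0) (𝓝 0) := by
    have : Tendsto (fun ε : ℝ => ε • v) (𝓝 0) (𝓝 ((0 : ℝ) • v)) :=
      (continuous_id.smul continuous_const).tendsto _
    rw [zero_smul] at this
    exact this.mono_left nhdsWithin_le_nhds
  obtain ⟨ε, h2, h3⟩ := ((eventually_stronglyLT h1 tendsto_const_nhds h).and
    self_mem_nhdsWithin).exists
  exact ⟨ε, h3, h2.le⟩

variable [IsOrderedModule ℝ V]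

/-- Strongly positive vectors are order units, with the bound linear in the norm. -/
theorem StronglyLT.exists_le_norm_smul {v : V} (h : StronglyLT 0 v) :
    ∃ C : ℝ, 0 < C ∧ ∀ u : V, u ≤ (C * ‖u‖) • v := by
  have h1 : ∀ᶠ u : V in 𝓝 0, StronglyLT u v :=
    eventually_stronglyLT tendsto_id tendsto_const_nhds h
  obtain ⟨r, hr, hr'⟩ := Metric.eventually_nhds_iff.1 h1
  refine ⟨2 / r, by positivity, fun u => ?_⟩
  rcases eq_or_ne u 0 with rfl | hu
  · simp
  have hu' : 0 < ‖u‖ := norm_pos_iff.2 hu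
  have hc : 0 < r / (2 * ‖u‖) := by positivity
  have h2 : (r / (2 * ‖u‖)) • u ≤ v := by
    refine (hr' ?_).le
    rw [dist_zero_right, norm_smul, Real.norm_of_nonneg hc.le]
    field_simp
    linarith
  have h3 := smul_le_smul_of_nonneg_left h2 (by positivity : 0 ≤ 2 / r * ‖u‖)
  rw [smul_smul] at h3
  have h4 : 2 / r * ‖u‖ * (r / (2 * ‖u‖)) = 1 := by field_simp
  rwa [h4, one_smul] at h3

theorem StronglyLT.lt [Nontrivial V] {a b : V} (h : StronglyLT a b) : a < b := by
  refine h.le.lt_of_ne ?_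
  rintro rfl
  have h0 : StronglyLT (0 : V) 0 := by simpa [StronglyLT] using h
  obtain ⟨x, hx⟩ := exists_ne (0 : V)
  obtain ⟨C, -, hC⟩ := h0.exists_le_norm_smul
  have h1 := hC x
  have h2 := hC (-x)
  rw [smul_zero] at h1 h2
  exact hx (le_antisymm h1 (neg_nonpos.1 h2))

end StrongOrder

/-! ### The spectral radius -/

section SpectralRadius

variable {R : Type*} [NormedRing R]

theorem exists_norm_pow_le_of_specRadius_lt {a : R} {s : ℝ} (hs : 0 < s)
    (h : specRadius a < ENNReal.ofReal s) : ∃ C : ℝ, 0 < C ∧ ∀ n, ‖a ^ n‖ ≤ C * s ^ n := by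
  have h1 : ∀ᶠ n : ℕ in atTop, ‖a ^ n‖ ≤ s ^ n := by
    filter_upwards [eventually_lt_of_limsup_lt h, eventually_gt_atTop 0] with n hn hn0
    have hn0' : (n : ℝ) ≠ 0 := by positivity
    have h2 := ENNReal.rpow_le_rpow hn.le (z := n) (by positivity)
    rw [← ENNReal.rpow_mul, one_div, inv_mul_cancel₀ hn0', ENNReal.rpow_one, ENNReal.rpow_natCast,
      ← ENNReal.ofReal_pow hs.le, ← enorm_eq_nnnorm, ← ofReal_norm] at h2
    exact (ENNReal.ofReal_le_ofReal_iff (by positivity)).1 h2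
  obtain ⟨N, hN⟩ := eventually_atTop.1 h1
  refine ⟨1 + ∑ n ∈ Finset.range N, ‖a ^ n‖ / s ^ n, by positivity, fun n => ?_⟩
  rcases lt_or_ge n N with hn | hn
  · have := Finset.single_le_sum (f := fun n => ‖a ^ n‖ / s ^ n) (fun i _ => by positivity)
      (Finset.mem_range.2 hn)
    rw [← div_le_iff₀ (by positivity)]
    linarith
  · refine (hN n hn).trans (le_mul_of_one_le_left (by positivity) ?_)
    have : 0 ≤ ∑ n ∈ Finset.range N, ‖a ^ n‖ / s ^ n := Finset.sum_nonneg fun i _ => by positivity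
    linarith

theorem specRadius_le_of_norm_pow_le {a : R} {C s : ℝ} (hC : 0 < C) (hs : 0 < s)
    (h : ∀ n, ‖a ^ n‖ ≤ C * s ^ n) : specRadius a ≤ ENNReal.ofReal s := by
  have h1 : Tendsto (fun n : ℕ => ENNReal.ofReal (C ^ (1 / n : ℝ) * s)) atTop
      (𝓝 (ENNReal.ofReal s)) := by
    refine ENNReal.tendsto_ofReal ?_
    have h2 : Tendsto (fun n : ℕ => C ^ (1 / n : ℝ)) atTop (𝓝 (C ^ (0 : ℝ))) :=
      tendsto_const_nhds.rpow tendsto_one_div_atTop_nhds_zero_nat (Or.inl hC.ne')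
    simpa using h2.mul_const s
  rw [specRadius, ← h1.limsup_eq]
  refine limsup_le_limsup ?_
  filter_upwards [eventually_gt_atTop 0] with n hn0
  have hn0' : (n : ℝ) ≠ 0 := by positivity
  rw [one_div, ENNReal.rpow_inv_le_iff (by positivity), ENNReal.rpow_natCast,
    ← ENNReal.ofReal_pow (by positivity), mul_pow, ← Real.rpow_natCast, ← Real.rpow_mul hC.le,
    inv_mul_cancel₀ hn0', Real.rpow_one, ← enorm_eq_nnnorm, ← ofReal_norm]
  exact ENNReal.ofReal_le_ofReal (h n)

theorem one_le_specRadius {a : R} (h : ∀ n, 1 ≤ ‖a ^ n‖) : 1 ≤ specRadius a := by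
  refine le_limsup_of_frequently_le (Eventually.frequently (Eventually.of_forall fun n => ?_))
  rw [← ENNReal.one_rpow (1 / n : ℝ)]
  refine ENNReal.rpow_le_rpow ?_ (by positivity)
  exact_mod_cast h n

/-- If `a` and `b` commute, `ρ(a) < 1` and `ρ(b) ≤ 1`, and some power of `c` is `a * b`, then
`ρ(c) < 1`. -/
theorem specRadius_lt_one_of_pow_eq_mul {a b c : R} {m : ℕ} (hm : 0 < m)
    (hc : c ^ m = a * b) (hab : Commute a b) (ha : specRadius a < 1) (hb : specRadius b ≤ 1) :
    specRadius c < 1 := by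
  obtain ⟨α, hα1, hα⟩ := ENNReal.lt_iff_exists_nnreal_btwn.1 ha
  have hα' : (α : ℝ) < 1 := by exact_mod_cast hα
  obtain ⟨α₁, hαα, hα₁⟩ := exists_between hα'
  have hα₁0 : 0 < α₁ := lt_of_le_of_lt α.2 hαα
  obtain ⟨β, hβ1, hβ⟩ := exists_between ((one_lt_inv₀ hα₁0).2 hα₁)
  have hβ0 : 0 < β := zero_lt_one.trans hβ1
  have hr1 : α₁ * β < 1 := by
    rw [lt_inv_comm₀ hβ0 hα₁0, inv_eq_one_div, lt_div_iff₀ hβ0] at hβ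
    exact hβ
  obtain ⟨A, hA, hAn⟩ := exists_norm_pow_le_of_specRadius_lt (a := a) hα₁0 (by
    refine hα1.trans ?_
    rw [← ENNReal.ofReal_coe_nnreal]
    exact (ENNReal.ofReal_lt_ofReal_iff hα₁0).2 hαα)
  obtain ⟨B, hB, hBn⟩ := exists_norm_pow_le_of_specRadius_lt (a := b) hβ0
    (hb.trans_lt (by rw [← ENNReal.ofReal_one]; exact (ENNReal.ofReal_lt_ofReal_iff hβ0).2 hβ1))
  set r := α₁ * β with hr
  have hr0 : 0 < r := by positivity
  set s : ℝ := r ^ (1 / m : ℝ) with hs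
  have hs0 : 0 < s := by positivity
  have hs1 : s < 1 := Real.rpow_lt_one hr0.le hr1 (by positivity)
  have hsm : s ^ m = r := by
    rw [hs, ← Real.rpow_natCast, ← Real.rpow_mul hr0.le, one_div,
      inv_mul_cancel₀ (by positivity), Real.rpow_one]
  let L : ℝ := ∑ i ∈ Finset.range m, ‖c ^ i‖
  have hL : 0 ≤ L := Finset.sum_nonneg fun i _ => norm_nonneg _
  refine lt_of_le_of_lt (specRadius_le_of_norm_pow_le (C := A * B * L / s ^ m + 1) (s := s)
    (by positivity) hs0 fun n => ?_) (by
      rw [← ENNReal.ofReal_one]; exact (ENNReal.ofReal_lt_ofReal_iff zero_lt_one).2 hs1)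
  have hn : n = m * (n / m) + n % m := (Nat.div_add_mod n m).symm
  have h1 : ‖c ^ n‖ ≤ A * B * L * r ^ (n / m) := by
    calc ‖c ^ n‖ = ‖a ^ (n / m) * b ^ (n / m) * c ^ (n % m)‖ := by
          conv_lhs => rw [hn, pow_add, pow_mul, hc, hab.mul_pow]
      _ ≤ ‖a ^ (n / m)‖ * ‖b ^ (n / m)‖ * ‖c ^ (n % m)‖ :=
          (norm_mul_le _ _).trans (by gcongr; exact norm_mul_le _ _)
      _ ≤ A * α₁ ^ (n / m) * (B * β ^ (n / m)) * L := by
          gcongr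
          · exact hAn _
          · exact hBn _
          · exact Finset.single_le_sum (f := fun i => ‖c ^ i‖) (fun i _ => norm_nonneg _)
              (Finset.mem_range.2 (Nat.mod_lt n hm))
      _ = A * B * L * r ^ (n / m) := by rw [hr, mul_pow]; ring
  have h2 : r ^ (n / m) * s ^ m ≤ s ^ n := by
    rw [← hsm, ← pow_mul, ← pow_add]
    refine pow_le_pow_of_le_one hs0.le hs1.le ?_
    have := Nat.mod_lt n hm
    omega
  have h3 : r ^ (n / m) ≤ s ^ n / s ^ m := (le_div_iff₀ (by positivity)).2 h2
  calc ‖c ^ n‖ ≤ A * B * L * r ^ (n / m) := h1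
    _ ≤ A * B * L * (s ^ n / s ^ m) := by gcongr
    _ = A * B * L / s ^ m * s ^ n := by ring
    _ ≤ (A * B * L / s ^ m + 1) * s ^ n := by gcongr; linarith

end SpectralRadius

/-! ### Backward orbits of compact operators -/

section CompactOperator

theorem exists_strict_record {a : ℕ → ℝ} (ha : ¬ BddAbove (range a)) (k : ℕ) :
    ∃ n, k < n ∧ ∀ j < n, a j < a n := by
  obtain ⟨M, hM⟩ : ∃ M, ∀ j ≤ k, a j ≤ M := by
    obtain ⟨M, hM⟩ := ((finite_Iic k).image a).bddAbove
    exact ⟨M, fun j hj => hM ⟨j, hj, rfl⟩⟩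
  have hex : ∃ n, M < a n := by
    by_contra! h
    exact ha ⟨M, by rintro _ ⟨n, rfl⟩; exact h n⟩
  classical
  refine ⟨Nat.find hex, ?_, fun j hj => ?_⟩
  · by_contra! h
    exact absurd (Nat.find_spec hex) (not_lt.2 (hM _ h))
  · exact (not_lt.1 (Nat.find_min hex hj)).trans_lt (Nat.find_spec hex)

variable {V : Type*} [NormedAddCommGroup V] [NormedSpace ℝ V]

theorem exists_tendsto_of_isCompactOperator {D : V →L[ℝ] V} (hD : IsCompactOperator D)
    {ι : Type*} {𝒰 : Ultrafilter ι} {u : ι → V} {C : ℝ} (hu : ∀ᶠ i in 𝒰, ‖u i‖ ≤ C) :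
    ∃ z, Tendsto (fun i => D (u i)) 𝒰 (𝓝 z) := by
  have hK := IsCompactOperator.isCompact_closure_image_closedBall (f := (D : V →ₗ[ℝ] V)) hD C
  have hmem : ∀ᶠ i in 𝒰, D (u i) ∈ closure ((D : V →ₗ[ℝ] V) '' Metric.closedBall 0 C) := by
    filter_upwards [hu] with i hi
    exact subset_closure ⟨u i, by simpa using hi, rfl⟩
  obtain ⟨z, -, hz⟩ := hK.ultrafilter_le_nhds' (𝒰.map fun i => D (u i)) hmem
  exact ⟨z, hz⟩

/-- The first `n` steps of an orbit of a compact operator, read backwards from a time `n` at which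
`‖D ^ n u‖ * μ ^ n` is comparable to its maximum so far, accumulate as `n → ∞` at a backward orbit
with the decay `μ ^ j`. -/
theorem exists_backward_orbit {D : V →L[ℝ] V} (hD : IsCompactOperator D) {C : Set V}
    (hC : IsClosed C) {N : ℕ → ℕ} (hN : ∀ k, k < N k) {u : ℕ → V} {M μ : ℝ}
    (hu : ∀ n, ∀ j ≤ N n, ‖(D ^ (N n - j)) (u n)‖ ≤ M * μ ^ j)
    (h1 : ∀ n, ‖(D ^ N n) (u n)‖ = 1) (hmem : ∀ n k, (D ^ k) (u n) ∈ C) :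
    ∃ z : ℕ → V, (∀ j, z j ∈ C ∧ (D ^ j) (z j) = z 0 ∧ ‖z j‖ ≤ M * μ ^ j) ∧ ‖z 0‖ = 1 := by
  let 𝒰 : Ultrafilter ℕ := hyperfilter ℕ
  have h𝒰 : (𝒰 : Filter ℕ) ≤ atTop := Nat.hyperfilter_le_atTop
  have hge : ∀ j, ∀ᶠ n in 𝒰, j ≤ N n := fun j =>
    h𝒰 ((eventually_ge_atTop j).mono fun n hn => hn.trans (hN n).le)
  have hsucc : ∀ j, ∀ᶠ n in 𝒰, D ((D ^ (N n - (j + 1))) (u n)) = (D ^ (N n - j)) (u n) := by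
    intro j
    filter_upwards [hge (j + 1)] with n hn
    have : N n - j = (N n - (j + 1)) + 1 := by omega
    rw [this, pow_succ', mul_apply_eq_comp]
  have hlim : ∀ j, ∃ z, Tendsto (fun n => (D ^ (N n - j)) (u n)) 𝒰 (𝓝 z) := by
    intro j
    obtain ⟨z, hz⟩ := exists_tendsto_of_isCompactOperator hD (𝒰 := 𝒰)
      (u := fun n => (D ^ (N n - (j + 1))) (u n)) (C := M * μ ^ (j + 1))
      ((hge (j + 1)).mono fun n hn => hu n _ hn)
    exact ⟨z, hz.congr' (hsucc j)⟩
  choose z hz using hlim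
  have hstep : ∀ j, D (z (j + 1)) = z j := fun j =>
    tendsto_nhds_unique (((D.continuous.tendsto _).comp (hz (j + 1))).congr' (hsucc j)) (hz j)
  have hpow : ∀ j, (D ^ j) (z j) = z 0 := by
    intro j
    induction j with
    | zero => simp
    | succ j ih => rw [pow_succ, mul_apply_eq_comp, hstep, ih]
  refine ⟨z, fun j => ⟨?_, hpow j, ?_⟩, ?_⟩
  · exact hC.mem_of_tendsto (hz j) (Eventually.of_forall fun n => hmem n _)
  · exact le_of_tendsto (hz j).norm ((hge j).mono fun n hn => hu n j hn)
  · exact tendsto_nhds_unique (hz 0).norm (tendsto_const_nhds.congr fun n => (h1 n).symm)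

/-- If the spectral radius of a compact operator exceeds `1`, some nonzero vector has a backward
orbit tending to `0` exponentially. -/
theorem exists_backward_orbit_of_one_lt_specRadius {D : V →L[ℝ] V} (hD : IsCompactOperator D)
    (hρ : 1 < specRadius D) :
    ∃ M μ : ℝ, 0 < M ∧ 0 < μ ∧ μ < 1 ∧ ∃ z : ℕ → V,
      (∀ j, (D ^ j) (z j) = z 0 ∧ ‖z j‖ ≤ M * μ ^ j) ∧ ‖z 0‖ = 1 := by
  obtain ⟨m, hm1, hm⟩ := ENNReal.lt_iff_exists_nnreal_btwn.1 hρ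
  have hm1' : (1 : ℝ) < m := by exact_mod_cast hm1
  have hm0 : (0 : ℝ) < m := zero_lt_one.trans hm1'
  set μ : ℝ := (m : ℝ)⁻¹ with hμ
  have hμ0 : 0 < μ := inv_pos.2 hm0
  have hunb : ¬ BddAbove (range fun n => ‖D ^ n‖ * μ ^ n) := by
    rintro ⟨B, hB⟩
    refine absurd hm (not_lt.2 ?_)
    rw [← ENNReal.ofReal_coe_nnreal]
    refine specRadius_le_of_norm_pow_le (C := |B| + 1) (by positivity) hm0 fun n => ?_
    have h1 : ‖D ^ n‖ * μ ^ n ≤ |B| + 1 := by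
      have := hB ⟨n, rfl⟩
      dsimp only at this
      linarith [le_abs_self B]
    rw [hμ, inv_pow, ← div_eq_mul_inv, div_le_iff₀ (by positivity)] at h1
    exact h1
  choose N hN hrec using exists_strict_record hunb
  have hle : ∀ n, ∀ j ≤ N n, ‖D ^ (N n - j)‖ ≤ ‖D ^ N n‖ * μ ^ j := by
    intro n j hj
    have h2 : ‖D ^ (N n - j)‖ * μ ^ (N n - j) ≤ ‖D ^ N n‖ * μ ^ N n := by
      rcases Nat.eq_zero_or_pos j with rfl | hj0
      · simp
      · exact (hrec n (N n - j) (by have := hN n; omega)).le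
    have h3 : μ ^ N n = μ ^ j * μ ^ (N n - j) := by rw [← pow_add]; congr 1; omega
    rw [h3, ← mul_assoc] at h2
    exact le_of_mul_le_mul_right h2 (by positivity)
  have hpos : ∀ n, 0 < ‖D ^ N n‖ := by
    intro n
    have h2 := hrec n 0 ((Nat.zero_le n).trans_lt (hN n))
    have h3 : 0 < ‖D ^ N n‖ * μ ^ N n := lt_of_le_of_lt (by positivity) h2
    exact pos_of_mul_pos_left h3 (by positivity)
  have hx : ∀ n, ∃ x : V, ‖x‖ < 1 ∧ ‖D ^ N n‖ / 2 < ‖(D ^ N n) x‖ := fun n =>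
    ContinuousLinearMap.exists_lt_apply_of_lt_opNorm _ (half_lt_self (hpos n))
  choose x hx1 hx2 using hx
  have hx0 : ∀ n, 0 < ‖(D ^ N n) (x n)‖ := fun n => (half_pos (hpos n)).trans (hx2 n)
  have hu : ∀ n, ∀ j ≤ N n,
      ‖(D ^ (N n - j)) (‖(D ^ N n) (x n)‖⁻¹ • x n)‖ ≤ 2 * μ ^ j := by
    intro n j hj
    rw [map_smul, norm_smul, norm_inv, norm_norm, inv_mul_le_iff₀ (hx0 n)]
    calc ‖(D ^ (N n - j)) (x n)‖ ≤ ‖D ^ (N n - j)‖ * ‖x n‖ := ContinuousLinearMap.le_opNorm _ _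
      _ ≤ ‖D ^ (N n - j)‖ * 1 := by gcongr; exact (hx1 n).le
      _ ≤ ‖D ^ N n‖ * μ ^ j := by rw [mul_one]; exact hle n j hj
      _ ≤ ‖(D ^ N n) (x n)‖ * (2 * μ ^ j) := by
        have := hx2 n
        have h4 : 0 < μ ^ j := by positivity
        nlinarith
  have hu1 : ∀ n, ‖(D ^ N n) (‖(D ^ N n) (x n)‖⁻¹ • x n)‖ = 1 := fun n => by
    rw [map_smul, norm_smul, norm_inv, norm_norm, inv_mul_cancel₀ (hx0 n).ne']
  obtain ⟨z, hz, hz0⟩ := exists_backward_orbit hD isClosed_univ hN hu hu1 fun _ _ => mem_univ _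
  exact ⟨2, μ, two_pos, hμ0, inv_lt_one_of_one_lt₀ hm1', z, fun j => (hz j).2, hz0⟩

/-- The version for the orbit of one vector: if `‖D ^ n v‖ * μ ^ n` is unbounded, a closed set that
is invariant under `D` and positive scalars and contains `v` contains such a backward orbit. -/
theorem exists_backward_orbit_of_not_bddAbove {D : V →L[ℝ] V} (hD : IsCompactOperator D) {C : Set V}
    (hC : IsClosed C) (hCs : ∀ c : ℝ, 0 < c → ∀ x ∈ C, c • x ∈ C) {v : V}
    (hv : ∀ k, (D ^ k) v ∈ C) {μ : ℝ} (hμ0 : 0 < μ)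
    (hunb : ¬ BddAbove (range fun n => ‖(D ^ n) v‖ * μ ^ n)) :
    ∃ z : ℕ → V, (∀ j, z j ∈ C ∧ (D ^ j) (z j) = z 0 ∧ ‖z j‖ ≤ μ ^ j) ∧ ‖z 0‖ = 1 := by
  choose N hN hrec using exists_strict_record hunb
  have hle : ∀ n, ∀ j ≤ N n, ‖(D ^ (N n - j)) v‖ ≤ ‖(D ^ N n) v‖ * μ ^ j := by
    intro n j hj
    have h2 : ‖(D ^ (N n - j)) v‖ * μ ^ (N n - j) ≤ ‖(D ^ N n) v‖ * μ ^ N n := by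
      rcases Nat.eq_zero_or_pos j with rfl | hj0
      · simp
      · exact (hrec n (N n - j) (by have := hN n; omega)).le
    have h3 : μ ^ N n = μ ^ j * μ ^ (N n - j) := by rw [← pow_add]; congr 1; omega
    rw [h3, ← mul_assoc] at h2
    exact le_of_mul_le_mul_right h2 (by positivity)
  have hpos : ∀ n, 0 < ‖(D ^ N n) v‖ := by
    intro n
    have h2 := hrec n 0 ((Nat.zero_le n).trans_lt (hN n))
    have h3 : 0 < ‖(D ^ N n) v‖ * μ ^ N n := lt_of_le_of_lt (by positivity) h2
    exact pos_of_mul_pos_left h3 (by positivity)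
  have hu : ∀ n, ∀ j ≤ N n, ‖(D ^ (N n - j)) (‖(D ^ N n) v‖⁻¹ • v)‖ ≤ 1 * μ ^ j := by
    intro n j hj
    rw [map_smul, norm_smul, norm_inv, norm_norm, inv_mul_le_iff₀ (hpos n), one_mul]
    exact hle n j hj
  have hu1 : ∀ n, ‖(D ^ N n) (‖(D ^ N n) v‖⁻¹ • v)‖ = 1 := fun n => by
    rw [map_smul, norm_smul, norm_inv, norm_norm, inv_mul_cancel₀ (hpos n).ne']
  obtain ⟨z, hz, hz0⟩ := exists_backward_orbit hD hC hN hu hu1 fun n k => by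
    rw [map_smul]
    exact hCs _ (inv_pos.2 (hpos n)) _ (hv k)
  exact ⟨z, fun j => by simpa using hz j, hz0⟩

end CompactOperator

/-! ### Compact positive operators -/

section PositiveOperator

variable {V : Type*} [NormedAddCommGroup V] [PartialOrder V]

/-- A sequence of upper bounds for both `z` and `-z` that tends to `0` forces `z = 0`; no normality
of the cone is needed. -/
theorem eq_zero_of_le_of_neg_le [IsOrderedAddMonoid V] [OrderClosedTopology V]
    {z : V} {f : ℕ → V} (hf : Tendsto f atTop (𝓝 0))
    (h1 : ∀ j, z ≤ f j) (h2 : ∀ j, -z ≤ f j) : z = 0 :=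
  le_antisymm (ge_of_tendsto' hf h1) (neg_nonpos.1 (ge_of_tendsto' hf h2))

variable [NormedSpace ℝ V]

theorem pow_apply_nonneg {D : V →L[ℝ] V} (hpos : ∀ u, 0 ≤ u → 0 ≤ D u) (n : ℕ) {u : V}
    (hu : 0 ≤ u) : 0 ≤ (D ^ n) u := by
  induction n with
  | zero => simpa
  | succ n ih => rw [pow_succ', mul_apply_eq_comp]; exact hpos _ ih

variable [IsOrderedAddMonoid V]

theorem IsStronglyPositive.apply_nonneg {P : V →L[ℝ] V} (hP : IsStronglyPositive P) {u : V}
    (hu : 0 ≤ u) : 0 ≤ P u := by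
  rcases hu.eq_or_lt with rfl | h
  · simp
  · exact (hP u h).le

theorem pow_apply_mono {D : V →L[ℝ] V} (hpos : ∀ u, 0 ≤ u → 0 ≤ D u) (n : ℕ) {u w : V}
    (h : u ≤ w) : (D ^ n) u ≤ (D ^ n) w := by
  rw [← sub_nonneg, ← map_sub]
  exact pow_apply_nonneg hpos n (sub_nonneg.2 h)

variable [IsOrderedModule ℝ V]

theorem pow_apply_le_of_norm_le {D : V →L[ℝ] V} (hpos : ∀ u, 0 ≤ u → 0 ≤ D u) {v : V} (hv : 0 ≤ v)
    {C : ℝ} (hC : 0 ≤ C) (hle : ∀ u : V, u ≤ (C * ‖u‖) • v) {z : V} {b : ℝ} (hz : ‖z‖ ≤ b) (j : ℕ) :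
    (D ^ j) z ≤ (C * b) • (D ^ j) v := by
  rw [← map_smul]
  exact pow_apply_mono hpos j
    ((hle z).trans (smul_le_smul_of_nonneg_right (mul_le_mul_of_nonneg_left hz hC) hv))

variable [OrderClosedTopology V]

/-- The order intervals from `-c • w` to `c • w` are invariant under `D`, so a backward orbit that
decays in norm must vanish; the cone need not be normal. -/
theorem specRadius_le_one_of_apply_eq {D : V →L[ℝ] V} (hD : IsCompactOperator D)
    (hpos : ∀ u, 0 ≤ u → 0 ≤ D u) {w : V} (hw : StronglyLT 0 w) (hDw : D w = w) :
    specRadius D ≤ 1 := by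
  by_contra! hρ
  obtain ⟨M, μ, hM, hμ0, hμ1, z, hz, hz0⟩ := exists_backward_orbit_of_one_lt_specRadius hD hρ
  obtain ⟨C, hC, hle⟩ := hw.exists_le_norm_smul
  have hDj : ∀ j, (D ^ j) w = w := by
    intro j
    induction j with
    | zero => simp
    | succ j ih => rw [pow_succ, mul_apply_eq_comp, hDw, ih]
  have hlim : Tendsto (fun j => (C * (M * μ ^ j)) • w) atTop (𝓝 0) := by
    have := ((tendsto_pow_atTop_nhds_zero_of_lt_one hμ0.le hμ1).const_mul M).const_mul C
    simpa using this.smul_const w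
  have hz00 : z 0 = 0 := by
    refine eq_zero_of_le_of_neg_le hlim (fun j => ?_) (fun j => ?_)
    · have := pow_apply_le_of_norm_le hpos hw.le hC.le hle (hz j).2 j
      rwa [(hz j).1, hDj] at this
    · have := pow_apply_le_of_norm_le hpos hw.le hC.le hle ((norm_neg (z j)).trans_le (hz j).2) j
      rwa [map_neg, (hz j).1, hDj] at this
  rw [hz00, norm_zero] at hz0
  exact zero_ne_one hz0

/-- Growth of order units: this replaces the principal eigenvector of the Krein–Rutman theorem. -/
theorem exists_smul_le_pow_apply {D : V →L[ℝ] V} (hD : IsCompactOperator D)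
    (hpos : ∀ u, 0 ≤ u → 0 ≤ D u) {v : V} (hv : StronglyLT 0 v) (hρ : 1 < specRadius D) :
    ∃ z : V, 0 < z ∧ ∃ c r : ℝ, 0 < c ∧ 1 < r ∧ ∀ j, (c * r ^ j) • z ≤ (D ^ j) v := by
  obtain ⟨M, μ, hM, hμ0, hμ1, y, hy, hy0⟩ := exists_backward_orbit_of_one_lt_specRadius hD hρ
  obtain ⟨C, hC, hle⟩ := hv.exists_le_norm_smul
  obtain ⟨ν, hν, hν1⟩ := exists_between hμ1
  have hν0 : 0 < ν := hμ0.trans hν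
  have hunb : ¬ BddAbove (range fun n => ‖(D ^ n) v‖ * ν ^ n) := by
    rintro ⟨B, hB⟩
    have hlim : Tendsto (fun j => (C * (M * μ ^ j)) • (D ^ j) v) atTop (𝓝 0) := by
      refine squeeze_zero_norm (a := fun j => C * M * B * (μ / ν) ^ j) (fun j => ?_) ?_
      · have h1 : ‖(D ^ j) v‖ * ν ^ j ≤ B := hB ⟨j, rfl⟩
        have h2 : (0 : ℝ) < μ ^ j := by positivity
        have h3 : (0 : ℝ) < ν ^ j := by positivity
        rw [norm_smul, Real.norm_of_nonneg (by positivity), div_pow]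
        rw [← le_div_iff₀ h3] at h1
        calc C * (M * μ ^ j) * ‖(D ^ j) v‖ ≤ C * (M * μ ^ j) * (B / ν ^ j) := by gcongr
          _ = C * M * B * (μ ^ j / ν ^ j) := by ring
      · have := (tendsto_pow_atTop_nhds_zero_of_lt_one (r := μ / ν) (by positivity)
          ((div_lt_one hν0).2 hν)).const_mul (C * M * B)
        simpa using this
    have : y 0 = 0 := by
      refine eq_zero_of_le_of_neg_le hlim (fun j => ?_) (fun j => ?_)
      · have := pow_apply_le_of_norm_le hpos hv.le hC.le hle (hy j).2 j
        rwa [(hy j).1] at this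
      · have := pow_apply_le_of_norm_le hpos hv.le hC.le hle ((norm_neg (y j)).trans_le (hy j).2) j
        rwa [map_neg, (hy j).1] at this
    rw [this, norm_zero] at hy0
    exact zero_ne_one hy0
  obtain ⟨z, hz, hz0⟩ := exists_backward_orbit_of_not_bddAbove hD (C := Ici 0) isClosed_Ici
    (fun c hc x hx => smul_nonneg hc.le hx) (fun k => pow_apply_nonneg hpos k hv.le) hν0 hunb
  have hz0' : z 0 ≠ 0 := by
    intro h
    rw [h, norm_zero] at hz0
    exact zero_ne_one hz0
  refine ⟨z 0, lt_of_le_of_ne (hz 0).1 hz0'.symm, C⁻¹, ν⁻¹, inv_pos.2 hC,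
    (one_lt_inv₀ hν0).2 hν1, fun j => ?_⟩
  have h1 := pow_apply_le_of_norm_le hpos hv.le hC.le hle (hz j).2.2 j
  rw [(hz j).2.1] at h1
  have h2 := smul_le_smul_of_nonneg_left h1 (by positivity : 0 ≤ C⁻¹ * ν⁻¹ ^ j)
  rw [smul_smul] at h2
  have h3 : C⁻¹ * ν⁻¹ ^ j * (C * ν ^ j) = 1 := by
    rw [inv_pow]; field_simp
  rwa [h3, one_smul] at h2

/-- Instability in terms of the order: a spectral radius above `1` expands every order unit `v`, in
the sense of `≪`, after enough iterations. -/
theorem exists_stronglyLT_apply_pow_apply {D P : V →L[ℝ] V} (hD : IsCompactOperator D)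
    (hpos : ∀ u, 0 ≤ u → 0 ≤ D u) (hP : IsStronglyPositive P) {v : V} (hv : StronglyLT 0 v)
    (hρ : 1 < specRadius D) : ∃ j, StronglyLT v (P ((D ^ j) v)) := by
  obtain ⟨z, hz, c, r, hc, hr, hle⟩ := exists_smul_le_pow_apply hD hpos hv hρ
  obtain ⟨ε, hε, hεz⟩ := (hP z hz).exists_smul_le v
  obtain ⟨j, hj⟩ := pow_unbounded_of_one_lt (2 / (c * ε)) hr
  refine ⟨j, ?_⟩
  have h1 : P ((c * r ^ j) • z) ≤ P ((D ^ j) v) := by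
    rw [← sub_nonneg, ← map_sub]
    exact hP.apply_nonneg (sub_nonneg.2 (hle j))
  rw [map_smul] at h1
  have h2 := (smul_le_smul_of_nonneg_left hεz (by positivity : 0 ≤ c * r ^ j)).trans h1
  rw [smul_smul] at h2
  have h3 : 2 ≤ c * r ^ j * ε := by
    rw [div_lt_iff₀ (by positivity)] at hj
    nlinarith
  have h4 : StronglyLT v ((2 : ℝ) • v) := by
    have : (2 : ℝ) • v - v = v - 0 := by rw [two_smul]; abel
    rw [StronglyLT, this]
    exact hv
  exact (h4.trans_le (smul_le_smul_of_nonneg_right h3 hv.le)).trans_le h2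

/-- A strongly positive operator with a strongly positive subinvariant vector `z` fixes only
vectors comparable to `0`: look at the least multiple of `z` above `w`. -/
theorem nonneg_or_nonpos_of_apply_eq {D : V →L[ℝ] V} (hD : IsStronglyPositive D) {z : V}
    (hz : StronglyLT 0 z) (hDz : D z ≤ z) {w : V} (hDw : D w = w) : 0 ≤ w ∨ w ≤ 0 := by
  by_contra! hw
  obtain ⟨hw1, hw2⟩ := hw
  obtain ⟨C, hC, hle⟩ := hz.exists_le_norm_smul
  let A : Set ℝ := {c | w ≤ c • z}
  have hAc : IsClosed A := isClosed_le continuous_const (continuous_id.smul continuous_const)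
  have hA0 : ∀ c ∈ A, 0 ≤ c := by
    intro c hc
    by_contra! h
    have hc' : w ≤ c • z := hc
    exact hw2 (hc'.trans (smul_nonpos_of_nonpos_of_nonneg h.le hz.le))
  have hAb : BddBelow A := ⟨0, hA0⟩
  have hmem : sInf A ∈ A := hAc.csInf_mem ⟨_, hle w⟩ hAb
  set s := sInf A with hs
  have hs' : w ≤ s • z := hmem
  have hlt : 0 < s • z - w := by
    refine lt_of_le_of_ne (sub_nonneg.2 hs') fun h => hw1 ?_
    rw [sub_eq_zero.1 h.symm |>.symm]
    exact smul_nonneg (hA0 _ hmem) hz.le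
  have h1 := hD _ hlt
  rw [map_sub, map_smul, hDw] at h1
  have h2 : StronglyLT 0 (s • z - w) :=
    h1.trans_le (sub_le_sub_right (smul_le_smul_of_nonneg_left hDz (hA0 _ hmem)) _)
  obtain ⟨ε, hε, h3⟩ := h2.exists_smul_le z
  have h4 : s - ε ∈ A := by
    change w ≤ (s - ε) • z
    rw [sub_smul]
    exact le_sub_comm.1 h3
  linarith [csInf_le hAb h4]

/-- The resolvent vectors `R = ∑ s⁻ⁿ Dⁿ v` satisfy `D R ≤ s R`; normalise them and let `s ↓ 1`. -/
theorem exists_apply_le_of_specRadius_le_one [CompleteSpace V] [Nontrivial V] {D : V →L[ℝ] V}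
    (hD : IsCompactOperator D) (hDp : IsStronglyPositive D) {v : V} (hv : StronglyLT 0 v)
    (hρ : specRadius D ≤ 1) : ∃ z, StronglyLT 0 z ∧ D z ≤ z := by
  have hpos : ∀ u, 0 ≤ u → 0 ≤ D u := fun u => hDp.apply_nonneg
  obtain ⟨C, hC, hle⟩ := hv.exists_le_norm_smul
  -- `a` stands for `1 / s`
  have hR : ∀ a : ℝ, 0 < a → a < 1 → ∃ R : V, v ≤ R ∧ a • D R = R - v := by
    intro a ha0 ha1
    obtain ⟨b, hb1, hb2⟩ := exists_between ((one_lt_inv₀ ha0).2 ha1)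
    have hb0 : 0 < b := zero_lt_one.trans hb1
    obtain ⟨B, hB, hBn⟩ := exists_norm_pow_le_of_specRadius_lt (a := D) hb0
      (hρ.trans_lt (by rw [← ENNReal.ofReal_one]; exact (ENNReal.ofReal_lt_ofReal_iff hb0).2 hb1))
    have hab : a * b < 1 := by
      rw [lt_inv_comm₀ hb0 ha0, inv_eq_one_div, lt_div_iff₀ hb0] at hb2
      exact hb2
    have hsum : Summable fun n => a ^ n • (D ^ n) v := by
      refine Summable.of_norm_bounded (g := fun n => B * ‖v‖ * (a * b) ^ n)
        ((summable_geometric_of_lt_one (by positivity) hab).mul_left _) fun n => ?_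
      rw [norm_smul, norm_pow, Real.norm_of_nonneg ha0.le, mul_pow]
      calc a ^ n * ‖(D ^ n) v‖ ≤ a ^ n * (B * b ^ n * ‖v‖) := by
            gcongr
            exact (ContinuousLinearMap.le_opNorm _ _).trans (by gcongr; exact hBn n)
        _ = B * ‖v‖ * (a ^ n * b ^ n) := by ring
    refine ⟨∑' n, a ^ n • (D ^ n) v, ?_, ?_⟩
    · rw [hsum.tsum_eq_zero_add]
      simp only [pow_zero, one_smul, one_apply_eq_self]
      exact le_add_of_nonneg_right
        (tsum_nonneg fun n => smul_nonneg (by positivity) (pow_apply_nonneg hpos _ hv.le))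
    · conv_rhs => rw [hsum.tsum_eq_zero_add]
      rw [D.map_tsum hsum, ← tsum_const_smul'']
      simp only [pow_zero, one_smul, one_apply_eq_self, add_sub_cancel_left]
      refine tsum_congr fun n => ?_
      rw [map_smul, smul_smul, ← pow_succ', pow_succ' D, mul_apply_eq_comp]
  have ha : ∀ n : ℕ, (0 : ℝ) < 1 - 1 / (n + 2) ∧ (1 : ℝ) - 1 / (n + 2) < 1 := by
    intro n
    have h1 : (0 : ℝ) < n + 2 := by positivity
    refine ⟨?_, by have : (0 : ℝ) < 1 / (n + 2) := by positivity
                   linarith⟩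
    rw [sub_pos, div_lt_one h1]
    linarith [(Nat.cast_nonneg n : (0 : ℝ) ≤ n)]
  choose R hvR hDR using fun n : ℕ => hR _ (ha n).1 (ha n).2
  have hv0 : 0 < v := hv.lt
  have hCR : ∀ n, 1 ≤ C * ‖R n‖ := by
    intro n
    by_contra! h
    have h1 := (hvR n).trans (hle (R n))
    have h2 : (1 - C * ‖R n‖) • v ≤ 0 := by
      rw [sub_smul, one_smul]
      exact sub_nonpos.2 h1
    have h3 : 0 ≤ (1 - C * ‖R n‖) • v := smul_nonneg (sub_pos.2 h).le hv0.le
    exact (smul_ne_zero (sub_pos.2 h).ne' hv0.ne') (le_antisymm h2 h3)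
  have hRpos : ∀ n, 0 < ‖R n‖ := fun n => by
    have := hCR n
    by_contra! h
    have : C * ‖R n‖ ≤ 0 := mul_nonpos_of_nonneg_of_nonpos hC.le h
    linarith [hCR n]
  let 𝒰 : Ultrafilter ℕ := hyperfilter ℕ
  have h𝒰 : (𝒰 : Filter ℕ) ≤ atTop := Nat.hyperfilter_le_atTop
  let y : ℕ → V := fun n => ‖R n‖⁻¹ • R n
  have hy1 : ∀ n, ‖y n‖ = 1 := fun n => by
    simp only [y, norm_smul, norm_inv, norm_norm, inv_mul_cancel₀ (hRpos n).ne']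
  obtain ⟨q, hq⟩ := exists_tendsto_of_isCompactOperator hD (𝒰 := 𝒰) (u := y) (C := 1)
    (Eventually.of_forall fun n => (hy1 n).le)
  obtain ⟨κ, hκ0, hκ⟩ := (isCompact_Icc (a := (0 : ℝ)) (b := C)).ultrafilter_le_nhds'
    (𝒰.map fun n => ‖R n‖⁻¹) (by
      refine Ultrafilter.mem_map.2 (Eventually.of_forall (f := (𝒰 : Filter ℕ)) fun n => ?_)
      exact ⟨(inv_pos.2 (hRpos n)).le, (inv_le_iff_one_le_mul₀ (hRpos n)).2 (hCR n)⟩)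
  have hκ' : Tendsto (fun n => ‖R n‖⁻¹) 𝒰 (𝓝 κ) := hκ
  have hlim1 : Tendsto (fun n : ℕ => (1 : ℝ) - 1 / (n + 2)) 𝒰 (𝓝 1) := by
    have h1 : Tendsto (fun n : ℕ => (1 : ℝ) / ((n : ℝ) + 2)) atTop (𝓝 0) :=
      tendsto_const_nhds.div_atTop
        (tendsto_atTop_add_const_right _ _ tendsto_natCast_atTop_atTop)
    simpa using (h1.const_sub 1).mono_left h𝒰
  have hyeq : ∀ n : ℕ, ((1 : ℝ) - 1 / (n + 2)) • D (y n) + ‖R n‖⁻¹ • v = y n := by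
    intro n
    simp only [y, map_smul]
    rw [smul_comm, hDR n, ← smul_add, sub_add_cancel]
  have hylim : Tendsto y 𝒰 (𝓝 (q + κ • v)) := by
    have h1 := (hlim1.smul hq).add (hκ'.smul_const v)
    rw [one_smul] at h1
    exact h1.congr hyeq
  set z := q + κ • v with hz
  have hDz : D z = q := tendsto_nhds_unique ((D.continuous.tendsto z).comp hylim) hq
  have hκv : 0 ≤ κ • v := smul_nonneg hκ0.1 hv0.le
  have hle' : D z ≤ z := by rw [hDz, hz]; exact le_add_of_nonneg_right hκv
  have hz0 : 0 ≤ z := ge_of_tendsto' hylim fun n =>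
    smul_nonneg (inv_pos.2 (hRpos n)).le (hv0.le.trans (hvR n))
  have hzne : z ≠ 0 := by
    intro h
    have h1 : ‖z‖ = 1 := tendsto_nhds_unique hylim.norm (by simp [hy1])
    rw [h, norm_zero] at h1
    exact zero_ne_one h1
  exact ⟨z, (hDp z (lt_of_le_of_ne hz0 hzne.symm)).trans_le hle', hle'⟩

/-- For a strongly positive operator, an eigenvector of eigenvalue `1` not comparable to `0` cannot
belong to the principal eigenvalue, which must therefore be larger. -/
theorem one_lt_specRadius_of_apply_eq [CompleteSpace V] [Nontrivial V] {D : V →L[ℝ] V}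
    (hD : IsCompactOperator D) (hDp : IsStronglyPositive D) {v : V} (hv : StronglyLT 0 v) {w : V}
    (hDw : D w = w) (hw1 : ¬ 0 ≤ w) (hw2 : ¬ w ≤ 0) : 1 < specRadius D := by
  by_contra! hρ
  obtain ⟨z, hz, hDz⟩ := exists_apply_le_of_specRadius_le_one hD hDp hv hρ
  exact (nonneg_or_nonpos_of_apply_eq hDp hz hDz hDw).elim hw1 hw2

end PositiveOperator

/-! ### Omega limit sets along ultrafilters -/

section OmegaLimit

variable {V : Type*} [NormedAddCommGroup V] {X : Set V} {Φ : Flow ℝ≥0 X}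

theorem exists_ultrafilter_of_frequently {ι : Type*} {l : Filter ι} {p : ι → Prop}
    (h : ∃ᶠ i in l, p i) : ∃ 𝒰 : Ultrafilter ι, (𝒰 : Filter ι) ≤ l ∧ ∀ᶠ i in 𝒰, p i := by
  have := frequently_iff_neBot.1 h
  obtain ⟨𝒰, h𝒰⟩ := exists_ultrafilter_le (l ⊓ 𝓟 {i | p i})
  exact ⟨𝒰, h𝒰.trans inf_le_left, le_principal_iff.1 (h𝒰.trans inf_le_right)⟩

theorem tendsto_flow {ι : Type*} {l : Filter ι} {τ : ι → ℝ≥0} {f : ι → X} {t : ℝ≥0} {x : X}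
    (hτ : Tendsto τ l (𝓝 t)) (hf : Tendsto f l (𝓝 x)) :
    Tendsto (fun i => Φ (τ i) (f i)) l (𝓝 (Φ t x)) :=
  (Φ.cont'.tendsto (t, x)).comp (hτ.prodMk_nhds hf)

theorem mem_equilibria_iff {e : X} : e ∈ equilibria Φ ↔ ∀ t, Φ t e = e := by
  change Φ.orbit e = {e} ↔ _
  rw [Flow.orbit_eq_range]
  constructor
  · intro h t
    have : Φ t e ∈ range fun t => Φ t e := ⟨t, rfl⟩
    rw [h] at this
    exact this
  · intro h
    simp only [h, range_const]

theorem isClosed_equilibria : IsClosed (equilibria Φ) := by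
  have : equilibria Φ = ⋂ t, {e | Φ t e = e} := by
    ext e
    simp [mem_equilibria_iff]
  rw [this]
  exact isClosed_iInter fun t =>
    isClosed_eq (Φ.continuous continuous_const continuous_id) continuous_id

theorem mem_omegaSet_iff {x p : X} : p ∈ omegaSet Φ x ↔
    ∃ 𝒰 : Ultrafilter ℝ≥0, (𝒰 : Filter ℝ≥0) ≤ atTop ∧ Tendsto (fun t => Φ t x) 𝒰 (𝓝 p) := by
  rw [omegaSet, mem_omegaLimit_singleton_iff_mapClusterPt, mapClusterPt_iff_ultrafilter]

theorem HasPrecompactOrbit.exists_tendsto {x : X} (hx : HasPrecompactOrbit Φ x)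
    (𝒰 : Ultrafilter ℝ≥0) : ∃ p, Tendsto (fun t => Φ t x) 𝒰 (𝓝 p) := by
  obtain ⟨p, -, hp⟩ := hx.ultrafilter_le_nhds' (𝒰.map fun t => Φ t x)
    (Ultrafilter.mem_map.2 (univ_mem' fun t => subset_closure (Φ.mem_orbit x t)))
  exact ⟨p, hp⟩

theorem exists_ultrafilter_le_atTop : ∃ 𝒰 : Ultrafilter ℝ≥0, (𝒰 : Filter ℝ≥0) ≤ atTop :=
  ⟨Ultrafilter.of atTop, Ultrafilter.of_le _⟩

theorem HasPrecompactOrbit.omegaSet_nonempty {x : X} (hx : HasPrecompactOrbit Φ x) :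
    (omegaSet Φ x).Nonempty := by
  obtain ⟨𝒰, h𝒰⟩ := exists_ultrafilter_le_atTop
  obtain ⟨p, hp⟩ := hx.exists_tendsto 𝒰
  exact ⟨p, mem_omegaSet_iff.2 ⟨𝒰, h𝒰, hp⟩⟩

theorem isClosed_omegaSet (x : X) : IsClosed (omegaSet Φ x) := isClosed_omegaLimit ..

theorem HasPrecompactOrbit.isCompact_omegaSet {x : X} (hx : HasPrecompactOrbit Φ x) :
    IsCompact (omegaSet Φ x) := by
  refine IsCompact.of_isClosed_subset hx (isClosed_omegaSet x) fun p hp => ?_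
  obtain ⟨𝒰, -, hp⟩ := mem_omegaSet_iff.1 hp
  exact mem_closure_of_tendsto hp (Eventually.of_forall fun t => Φ.mem_orbit x t)

theorem flow_mem_omegaSet {x p : X} (hp : p ∈ omegaSet Φ x) (t : ℝ≥0) : Φ t p ∈ omegaSet Φ x := by
  obtain ⟨𝒰, h𝒰, hp⟩ := mem_omegaSet_iff.1 hp
  refine mem_omegaSet_iff.2 ⟨𝒰.map (t + ·),
    (tendsto_atTop.2 fun b => (eventually_ge_atTop b).mono fun s hs =>
      hs.trans le_add_self : Tendsto (t + ·) atTop atTop).mono_left h𝒰, ?_⟩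
  have := tendsto_flow (Φ := Φ) (tendsto_const_nhds (x := t)) hp
  simp only [← Φ.map_add] at this
  exact this

theorem omegaSet_subset {x p : X} (hp : p ∈ omegaSet Φ x) : omegaSet Φ p ⊆ omegaSet Φ x := by
  intro q hq
  obtain ⟨𝒰, -, hq⟩ := mem_omegaSet_iff.1 hq
  exact (isClosed_omegaSet x).mem_of_tendsto hq (Eventually.of_forall (flow_mem_omegaSet hp))

theorem omegaSet_subset_omegaSet_flow (s : ℝ≥0) (x : X) :
    omegaSet Φ x ⊆ omegaSet Φ (Φ s x) := by
  intro p hp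
  obtain ⟨𝒰, h𝒰, hp⟩ := mem_omegaSet_iff.1 hp
  have hsub : Tendsto (fun t : ℝ≥0 => t - s) atTop atTop :=
    tendsto_atTop.2 fun b => (eventually_ge_atTop (b + s)).mono fun t ht =>
      le_tsub_of_add_le_right ht
  refine mem_omegaSet_iff.2 ⟨𝒰.map (· - s), hsub.mono_left h𝒰, ?_⟩
  refine (hp.congr' (h𝒰 ?_) : Tendsto (fun t => Φ (t - s) (Φ s x)) 𝒰 (𝓝 p))
  filter_upwards [eventually_ge_atTop s] with t ht
  rw [← Φ.map_add, tsub_add_cancel_of_le ht]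

theorem HasPrecompactOrbit.tendsto {x p : X} (hx : HasPrecompactOrbit Φ x)
    (h : ∀ q ∈ omegaSet Φ x, q = p) : Tendsto (fun t => Φ t x) atTop (𝓝 p) := by
  rw [tendsto_iff_ultrafilter]
  intro 𝒰 h𝒰
  obtain ⟨q, hq⟩ := hx.exists_tendsto 𝒰
  rwa [h q (mem_omegaSet_iff.2 ⟨𝒰, h𝒰, hq⟩)] at hq

theorem omegaSet_eq_singleton {x p : X} (h : Tendsto (fun t => Φ t x) atTop (𝓝 p)) :
    omegaSet Φ x = {p} := by
  ext q
  rw [mem_omegaSet_iff, mem_singleton_iff]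
  constructor
  · rintro ⟨𝒰, h𝒰, hq⟩
    exact tendsto_nhds_unique hq (h.mono_left h𝒰)
  · rintro rfl
    obtain ⟨𝒰, h𝒰⟩ := exists_ultrafilter_le_atTop
    exact ⟨𝒰, h𝒰, h.mono_left h𝒰⟩

theorem mem_equilibria_of_tendsto {x p : X} (h : Tendsto (fun t => Φ t x) atTop (𝓝 p)) :
    p ∈ equilibria Φ := by
  have hω := omegaSet_eq_singleton h
  rw [mem_equilibria_iff]
  intro t
  have := flow_mem_omegaSet (hω ▸ mem_singleton p : p ∈ omegaSet Φ x) t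
  rwa [hω] at this

/-- An omega limit set with two points has no isolated points: the orbit crosses every small
sphere around a limit point infinitely often. -/
theorem HasPrecompactOrbit.exists_mem_omegaSet_dist_eq {x e e' : X} (hx : HasPrecompactOrbit Φ x)
    (he : e ∈ omegaSet Φ x) (he' : e' ∈ omegaSet Φ x) {r : ℝ} (hr : 0 < r) (hr' : r < dist e e') :
    ∃ u ∈ omegaSet Φ x, dist u e = r := by
  obtain ⟨𝒰, h𝒰, h𝒰e⟩ := mem_omegaSet_iff.1 he
  obtain ⟨𝒲, h𝒲, h𝒲e⟩ := mem_omegaSet_iff.1 he'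
  have hfreq : ∃ᶠ t in atTop, dist (Φ t x) e = r := by
    rw [frequently_atTop]
    intro N
    have h1 : ∀ᶠ t in 𝒰, dist (Φ t x) e < r := h𝒰e.eventually (Metric.ball_mem_nhds e hr)
    obtain ⟨s, hs, hNs⟩ := (h1.and (h𝒰 (eventually_ge_atTop N))).exists
    have h2 : ∀ᶠ t in 𝒲, r < dist (Φ t x) e := by
      refine (h𝒲e.dist tendsto_const_nhds).eventually (lt_mem_nhds ?_)
      rwa [dist_comm]
    obtain ⟨s', hs', hss'⟩ := (h2.and (h𝒲 (eventually_ge_atTop s))).exists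
    have hcont : ContinuousOn (fun t => dist (Φ t x) e) (Icc s s') :=
      ((Φ.continuous continuous_id continuous_const).dist continuous_const).continuousOn
    obtain ⟨t, ht, htr⟩ := intermediate_value_Icc hss' hcont ⟨hs.le, hs'.le⟩
    exact ⟨t, hNs.trans ht.1, htr⟩
  obtain ⟨𝒱, h𝒱, h𝒱r⟩ := exists_ultrafilter_of_frequently hfreq
  obtain ⟨u, hu⟩ := hx.exists_tendsto 𝒱
  refine ⟨u, mem_omegaSet_iff.2 ⟨𝒱, h𝒱, hu⟩, ?_⟩
  exact tendsto_nhds_unique (hu.dist tendsto_const_nhds) (tendsto_const_nhds.congr'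
    (EventuallyEq.symm h𝒱r))

end OmegaLimit

/-! ### The limit set dichotomy -/

section Dichotomy

variable {V : Type*} [NormedAddCommGroup V] [PartialOrder V] {X : Set V} {Φ : Flow ℝ≥0 X}

theorem IsMonotone.le_flow_nsmul (hΦ : IsMonotone Φ) {x : X} {τ : ℝ≥0} (h : x ≤ Φ τ x) (n : ℕ) :
    x ≤ Φ (n • τ) x := by
  induction n with
  | zero => simp
  | succ n ih =>
    rw [succ_nsmul', Φ.map_add]
    exact h.trans (hΦ τ _ _ ih)

theorem IsEventuallyStronglyMonotone.exists_stronglyLT_flow (hΦ : IsEventuallyStronglyMonotone Φ) :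
    ∃ t₁ : ℝ≥0, ∀ (x y : X) (h k : ℝ≥0), Φ h x < Φ k y →
      StronglyLT (Φ (t₁ + h) x : V) (Φ (t₁ + k) y) := by
  obtain ⟨-, t₁, ht₁⟩ := hΦ
  refine ⟨t₁, fun x y h k hlt => ?_⟩
  rw [Φ.map_add, Φ.map_add]
  exact ht₁ _ _ hlt t₁ le_rfl

theorem eventually_flow_le [IsOrderedAddMonoid V] {x y : X} {h k : ℝ≥0}
    (hs : StronglyLT (Φ h x : V) (Φ k y)) :
    ∀ᶠ r : ℝ≥0 × ℝ≥0 in 𝓝 (h, k), Φ r.1 x ≤ Φ r.2 y := by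
  have hcoe : Continuous ((↑) : X → V) := continuous_subtype_val
  exact (eventually_stronglyLT
    ((hcoe.tendsto _).comp (tendsto_flow (Φ := Φ) (continuous_fst.tendsto (h, k))
      (tendsto_const_nhds (x := x))))
    ((hcoe.tendsto _).comp (tendsto_flow (Φ := Φ) (continuous_snd.tendsto (h, k))
      (tendsto_const_nhds (x := y)))) hs).mono fun r hr => hr.le

variable [OrderClosedTopology V]

/-- If `x ≤ Φ T x` for all `T` in an interval, then `x ≤ Φ T x` for all large `T`, and the orbit of
`x` has at most one limit point. -/
theorem IsMonotone.subsingleton_omegaSet (hΦ : IsMonotone Φ) {x : X} {T₀ : ℝ≥0} (hT₀ : 0 < T₀)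
    (h : ∀ᶠ T in 𝓝 T₀, x ≤ Φ T x) : (omegaSet Φ x).Subsingleton := by
  obtain ⟨δ, hδ, hδT⟩ := Metric.eventually_nhds_iff.1 h
  have hT₀' : (0 : ℝ) < T₀ := hT₀
  have hlarge : ∀ᶠ T : ℝ≥0 in atTop, x ≤ Φ T x := by
    filter_upwards [eventually_ge_atTop (T₀ * (Real.toNNReal (T₀ / δ) + 1))] with T hT
    have hT1 : (T₀ : ℝ) / δ + 1 ≤ T / T₀ := by
      rw [le_div_iff₀ hT₀', mul_comm]
      have : ((T₀ * (Real.toNNReal (T₀ / δ) + 1) : ℝ≥0) : ℝ) ≤ T := by exact_mod_cast hT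
      rw [NNReal.coe_mul, NNReal.coe_add, NNReal.coe_one, Real.coe_toNNReal _ (by positivity)]
        at this
      exact this
    set n := ⌊(T : ℝ) / T₀⌋₊ with hn
    have hn1 : (T : ℝ) / T₀ < n + 1 := Nat.lt_floor_add_one _
    have hn2 : (n : ℝ) ≤ T / T₀ := Nat.floor_le (by positivity)
    have hn3 : (T₀ : ℝ) / δ < n := by linarith
    have hn0 : (0 : ℝ) < n := lt_trans (by positivity) hn3
    have hn0' : (n : ℝ≥0) ≠ 0 := by exact_mod_cast hn0.ne'
    have hmem : dist (T / n) T₀ < δ := by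
      rw [NNReal.dist_eq, NNReal.coe_div, NNReal.coe_natCast, abs_lt]
      rw [div_lt_iff₀ hT₀'] at hn1
      rw [le_div_iff₀ hT₀'] at hn2
      rw [div_lt_iff₀ hδ] at hn3
      constructor
      · have : (T₀ : ℝ) ≤ T / n := by rw [le_div_iff₀ hn0]; linarith
        linarith
      · rw [sub_lt_iff_lt_add, div_lt_iff₀ hn0]
        nlinarith
    have := hΦ.le_flow_nsmul (hδT hmem) n
    rwa [nsmul_eq_mul, mul_div_cancel₀ _ hn0'] at this
  obtain ⟨M, hM⟩ := eventually_atTop.1 hlarge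
  have key : ∀ p ∈ omegaSet Φ x, ∀ q ∈ omegaSet Φ x, p ≤ q := by
    intro p hp q hq
    obtain ⟨𝒰, h𝒰, hp⟩ := mem_omegaSet_iff.1 hp
    obtain ⟨𝒲, h𝒲, hq⟩ := mem_omegaSet_iff.1 hq
    refine le_of_tendsto hp (Eventually.of_forall fun s => ?_)
    refine ge_of_tendsto hq (h𝒲 ?_)
    filter_upwards [eventually_ge_atTop (s + M)] with t ht
    have h1 := hΦ s _ _ (hM (t - s) (le_tsub_of_add_le_left ht))
    rwa [← Φ.map_add, add_tsub_cancel_of_le (le_self_add.trans ht)] at h1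
  exact fun p hp q hq => le_antisymm (key p hp q hq) (key q hq p hp)

/-- An order relation between the orbits of `x` and `y` with some delay passes to simultaneous limit
points with the same delay. -/
theorem IsMonotone.flow_le_flow_of_tendsto (hΦ : IsMonotone Φ) {𝒰 : Ultrafilter ℝ≥0}
    (h𝒰 : (𝒰 : Filter ℝ≥0) ≤ atTop) {x y p q : X} (hp : Tendsto (fun t => Φ t x) 𝒰 (𝓝 p))
    (hq : Tendsto (fun t => Φ t y) 𝒰 (𝓝 q)) {s h k : ℝ≥0} (hle : Φ (s + h) x ≤ Φ (s + k) y) :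
    Φ h p ≤ Φ k q := by
  have hp' := tendsto_flow (Φ := Φ) (tendsto_const_nhds (x := h)) hp
  have hq' := tendsto_flow (Φ := Φ) (tendsto_const_nhds (x := k)) hq
  refine le_of_tendsto_of_tendsto hp' hq' (h𝒰 ?_)
  filter_upwards [eventually_ge_atTop s] with t ht
  have := hΦ (t - s) _ _ hle
  rw [← Φ.map_add, ← Φ.map_add, ← add_assoc, ← add_assoc, tsub_add_cancel_of_le ht] at this
  rwa [← Φ.map_add, ← Φ.map_add, add_comm h, add_comm k]

theorem IsMonotone.le_of_tendsto (hΦ : IsMonotone Φ) {𝒰 : Ultrafilter ℝ≥0} {x y p q : X}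
    (hxy : x ≤ y) (hp : Tendsto (fun t => Φ t x) 𝒰 (𝓝 p))
    (hq : Tendsto (fun t => Φ t y) 𝒰 (𝓝 q)) : p ≤ q :=
  le_of_tendsto_of_tendsto' hp hq fun t => hΦ t _ _ hxy

variable [IsOrderedAddMonoid V]

/-- A point of `ω(x)` below all of `ω(y)` forces `ω(x) ≤ ω(y)`. -/
theorem IsEventuallyStronglyMonotone.omegaSet_le_of_lt_left (hΦ : IsEventuallyStronglyMonotone Φ)
    {x y e : X} (hy : HasPrecompactOrbit Φ y) (he : e ∈ omegaSet Φ x)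
    (hlt : ∀ f ∈ omegaSet Φ y, e < f) : ∀ a ∈ omegaSet Φ x, ∀ f ∈ omegaSet Φ y, a ≤ f := by
  obtain ⟨hmono, t₁, ht₁⟩ := hΦ
  have hcoe : Continuous ((↑) : X → V) := continuous_subtype_val
  have hev : ∀ᶠ r : X × ℝ≥0 in 𝓝 e ×ˢ atTop, StronglyLT (Φ t₁ r.1 : V) (Φ t₁ (Φ r.2 y)) := by
    by_contra hcon
    obtain ⟨𝒲, h𝒲, hW⟩ := exists_ultrafilter_of_frequently (not_eventually.1 hcon)
    have hW1 : Tendsto Prod.fst (𝒲 : Filter (X × ℝ≥0)) (𝓝 e) := tendsto_fst.mono_left h𝒲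
    have hW2 : Tendsto Prod.snd (𝒲 : Filter (X × ℝ≥0)) atTop := tendsto_snd.mono_left h𝒲
    obtain ⟨f, hf⟩ := hy.exists_tendsto (𝒲.map Prod.snd)
    have hfω : f ∈ omegaSet Φ y := mem_omegaSet_iff.2 ⟨𝒲.map Prod.snd, hW2, hf⟩
    have hf' : Tendsto (fun r : X × ℝ≥0 => Φ r.2 y) 𝒲 (𝓝 f) := hf
    have h1 := eventually_stronglyLT
      ((hcoe.tendsto _).comp (tendsto_flow (Φ := Φ) (tendsto_const_nhds (x := t₁)) hW1))
      ((hcoe.tendsto _).comp (tendsto_flow (Φ := Φ) (tendsto_const_nhds (x := t₁)) hf'))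
      (ht₁ e f (hlt f hfω) t₁ le_rfl)
    obtain ⟨r, hr1, hr2⟩ := (h1.and hW).exists
    exact hr2 hr1
  obtain ⟨𝒰, -, hU⟩ := mem_omegaSet_iff.1 he
  obtain ⟨s, hs⟩ := (hU.eventually hev.curry).exists
  obtain ⟨τ₀, hτ₀⟩ := eventually_atTop.1 hs
  intro a ha f hf
  obtain ⟨𝒱, h𝒱, hV⟩ := mem_omegaSet_iff.1 ha
  obtain ⟨𝒲, h𝒲, hW⟩ := mem_omegaSet_iff.1 hf
  refine _root_.le_of_tendsto hV (h𝒱 ?_)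
  filter_upwards [eventually_ge_atTop (t₁ + s)] with r hr
  refine ge_of_tendsto hW (h𝒲 ?_)
  filter_upwards [eventually_ge_atTop (r - (t₁ + s) + (t₁ + τ₀))] with t ht
  have h1 : τ₀ ≤ t - (r - (t₁ + s) + t₁) :=
    le_tsub_of_add_le_left (by rwa [add_assoc])
  have h2 : Φ t₁ (Φ s x) ≤ Φ t₁ (Φ (t - (r - (t₁ + s) + t₁)) y) := (hτ₀ _ h1).le
  have h3 := hmono (r - (t₁ + s)) _ _ h2
  have h4 : r - (t₁ + s) + t₁ + s = r := by rw [add_assoc, tsub_add_cancel_of_le hr]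
  rw [← Φ.map_add, ← Φ.map_add, ← Φ.map_add, ← Φ.map_add, h4, add_tsub_cancel_of_le] at h3
  · exact h3
  · exact le_trans (by rw [← add_assoc]; exact le_self_add) ht

/-- A point of `ω(y)` above all of `ω(x)` forces `ω(x) ≤ ω(y)`. -/
theorem IsEventuallyStronglyMonotone.omegaSet_le_of_lt_right (hΦ : IsEventuallyStronglyMonotone Φ)
    {x y f : X} (hx : HasPrecompactOrbit Φ x) (hf : f ∈ omegaSet Φ y)
    (hlt : ∀ e ∈ omegaSet Φ x, e < f) : ∀ a ∈ omegaSet Φ x, ∀ b ∈ omegaSet Φ y, a ≤ b := by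
  obtain ⟨hmono, t₁, ht₁⟩ := hΦ
  have hcoe : Continuous ((↑) : X → V) := continuous_subtype_val
  have hev : ∀ᶠ r : X × ℝ≥0 in 𝓝 f ×ˢ atTop, StronglyLT (Φ t₁ (Φ r.2 x) : V) (Φ t₁ r.1) := by
    by_contra hcon
    obtain ⟨𝒲, h𝒲, hW⟩ := exists_ultrafilter_of_frequently (not_eventually.1 hcon)
    have hW1 : Tendsto Prod.fst (𝒲 : Filter (X × ℝ≥0)) (𝓝 f) := tendsto_fst.mono_left h𝒲
    have hW2 : Tendsto Prod.snd (𝒲 : Filter (X × ℝ≥0)) atTop := tendsto_snd.mono_left h𝒲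
    obtain ⟨e, he⟩ := hx.exists_tendsto (𝒲.map Prod.snd)
    have heω : e ∈ omegaSet Φ x := mem_omegaSet_iff.2 ⟨𝒲.map Prod.snd, hW2, he⟩
    have he' : Tendsto (fun r : X × ℝ≥0 => Φ r.2 x) 𝒲 (𝓝 e) := he
    have h1 := eventually_stronglyLT
      ((hcoe.tendsto _).comp (tendsto_flow (Φ := Φ) (tendsto_const_nhds (x := t₁)) he'))
      ((hcoe.tendsto _).comp (tendsto_flow (Φ := Φ) (tendsto_const_nhds (x := t₁)) hW1))
      (ht₁ e f (hlt e heω) t₁ le_rfl)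
    obtain ⟨r, hr1, hr2⟩ := (h1.and hW).exists
    exact hr2 hr1
  obtain ⟨𝒰, -, hU⟩ := mem_omegaSet_iff.1 hf
  obtain ⟨s, hs⟩ := (hU.eventually hev.curry).exists
  obtain ⟨τ₀, hτ₀⟩ := eventually_atTop.1 hs
  intro a ha b hb
  obtain ⟨𝒱, h𝒱, hV⟩ := mem_omegaSet_iff.1 ha
  obtain ⟨𝒲, h𝒲, hW⟩ := mem_omegaSet_iff.1 hb
  refine ge_of_tendsto hW (h𝒲 ?_)
  filter_upwards [eventually_ge_atTop (t₁ + s)] with r hr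
  refine _root_.le_of_tendsto hV (h𝒱 ?_)
  filter_upwards [eventually_ge_atTop (r - (t₁ + s) + (t₁ + τ₀))] with t ht
  have h1 : τ₀ ≤ t - (r - (t₁ + s) + t₁) :=
    le_tsub_of_add_le_left (by rwa [add_assoc])
  have h2 : Φ t₁ (Φ (t - (r - (t₁ + s) + t₁)) x) ≤ Φ t₁ (Φ s y) := (hτ₀ _ h1).le
  have h3 := hmono (r - (t₁ + s)) _ _ h2
  have h4 : r - (t₁ + s) + t₁ + s = r := by rw [add_assoc, tsub_add_cancel_of_le hr]
  rw [← Φ.map_add, ← Φ.map_add, ← Φ.map_add, ← Φ.map_add, h4, add_tsub_cancel_of_le] at h3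
  · exact h3
  · exact le_trans (by rw [← add_assoc]; exact le_self_add) ht

/-- Two ordered orbits can only accumulate simultaneously at an equilibrium. -/
theorem IsEventuallyStronglyMonotone.mem_equilibria (hΦ : IsEventuallyStronglyMonotone Φ)
    {𝒰 : Ultrafilter ℝ≥0} (h𝒰 : (𝒰 : Filter ℝ≥0) ≤ atTop) {x y p : X} (hxy : x < y)
    (hx : Tendsto (fun t => Φ t x) 𝒰 (𝓝 p)) (hy : Tendsto (fun t => Φ t y) 𝒰 (𝓝 p)) :
    p ∈ equilibria Φ := by
  obtain ⟨t₁, ht₁⟩ := hΦ.exists_stronglyLT_flow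
  have h1 := ht₁ x y 0 0 (by simpa using hxy)
  have h2 := eventually_flow_le h1
  have hadd : Tendsto (fun r : ℝ≥0 × ℝ≥0 => (t₁ + r.1, t₁ + r.2)) (𝓝 (0, 0))
      (𝓝 (t₁ + 0, t₁ + 0)) := by
    exact (Continuous.tendsto (by fun_prop) _)
  have h3 := hadd.eventually h2
  have h4 : ∀ᶠ r : ℝ≥0 × ℝ≥0 in 𝓝 (0, 0), Φ r.1 p ≤ Φ r.2 p :=
    h3.mono fun r hr => hΦ.1.flow_le_flow_of_tendsto h𝒰 hx hy hr
  have h5 : ∀ᶠ h : ℝ≥0 in 𝓝 0, Φ h p = p := by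
    have ha : Tendsto (fun h : ℝ≥0 => (h, (0 : ℝ≥0))) (𝓝 0) (𝓝 (0, 0)) :=
      Continuous.tendsto (by fun_prop) _
    have hb : Tendsto (fun h : ℝ≥0 => ((0 : ℝ≥0), h)) (𝓝 0) (𝓝 (0, 0)) :=
      Continuous.tendsto (by fun_prop) _
    filter_upwards [ha.eventually h4, hb.eventually h4] with h h6 h7
    simp only [Φ.map_zero_apply] at h6 h7
    exact le_antisymm h6 h7
  rw [mem_equilibria_iff]
  intro t
  have h6 : Tendsto (fun n : ℕ => t / n) atTop (𝓝 0) := tendsto_const_div_atTop_nhds_zero_nat t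
  obtain ⟨n, hn, hn0⟩ := ((h6.eventually h5).and (eventually_gt_atTop 0)).exists
  have hn0' : (n : ℝ≥0) ≠ 0 := by exact_mod_cast hn0.ne'
  have h7 : ∀ m : ℕ, Φ (m • (t / n)) p = p := by
    intro m
    induction m with
    | zero => simp
    | succ m ih => rw [succ_nsmul, Φ.map_add, hn, ih]
  have := h7 n
  rwa [nsmul_eq_mul, mul_div_cancel₀ _ hn0'] at this

/-- If the limit points `p` and `q` of the orbits of `x` and `y` satisfy `Φ h p < Φ k q`, the weak
order relation persists for nearby delays. -/
theorem IsEventuallyStronglyMonotone.eventually_flow_le_of_lt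
    (hΦ : IsEventuallyStronglyMonotone Φ) {𝒰 : Ultrafilter ℝ≥0}
    (h𝒰 : (𝒰 : Filter ℝ≥0) ≤ atTop) {x y p q : X} (hp : Tendsto (fun t => Φ t x) 𝒰 (𝓝 p))
    (hq : Tendsto (fun t => Φ t y) 𝒰 (𝓝 q)) {h k : ℝ≥0} (hlt : Φ h p < Φ k q) :
    ∀ᶠ r : ℝ≥0 × ℝ≥0 in 𝓝 (h, k), Φ r.1 p ≤ Φ r.2 q := by
  obtain ⟨t₁, ht₁⟩ := hΦ.exists_stronglyLT_flow
  have h1 := ht₁ p q h k hlt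
  have hcoe : Continuous ((↑) : X → V) := continuous_subtype_val
  obtain ⟨s, hs⟩ := (eventually_stronglyLT
    ((hcoe.tendsto _).comp (tendsto_flow (Φ := Φ) (tendsto_const_nhds (x := t₁ + h)) hp))
    ((hcoe.tendsto _).comp (tendsto_flow (Φ := Φ) (tendsto_const_nhds (x := t₁ + k)) hq)) h1).exists
  have h2 := eventually_flow_le hs
  have hadd : Tendsto (fun r : ℝ≥0 × ℝ≥0 => (t₁ + r.1, t₁ + r.2)) (𝓝 (h, k))
      (𝓝 (t₁ + h, t₁ + k)) := Continuous.tendsto (by fun_prop) _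
  refine (hadd.eventually h2).mono fun r hr => ?_
  refine hΦ.1.flow_le_flow_of_tendsto h𝒰 hp hq (s := t₁ + s) ?_
  rwa [add_right_comm, Φ.map_add (t₁ + r.1), add_right_comm, Φ.map_add (t₁ + r.2)]

variable [NormedSpace ℝ V] [IsOrderedModule ℝ V] [Nontrivial V]

/-- Omega limit sets are unordered. -/
theorem IsEventuallyStronglyMonotone.not_lt_of_mem_omegaSet (hΦ : IsEventuallyStronglyMonotone Φ)
    {x a b : X} (ha : a ∈ omegaSet Φ x) (hb : b ∈ omegaSet Φ x) : ¬ a < b := by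
  intro hab
  obtain ⟨hmono, t₁, ht₁⟩ := hΦ
  have hs := ht₁ a b hab t₁ le_rfl
  have ha' := flow_mem_omegaSet ha t₁
  have hb' := flow_mem_omegaSet hb t₁
  obtain ⟨𝒰, h𝒰, hU⟩ := mem_omegaSet_iff.1 ha'
  obtain ⟨𝒲, h𝒲, hW⟩ := mem_omegaSet_iff.1 hb'
  have hcoe : Continuous ((↑) : X → V) := continuous_subtype_val
  obtain ⟨s, hs'⟩ := (eventually_stronglyLT ((hcoe.tendsto _).comp hU)
    (tendsto_const_nhds (x := ((Φ t₁ b : X) : V))) hs).exists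
  obtain ⟨t, ht, hst⟩ := ((eventually_stronglyLT (tendsto_const_nhds (x := ((Φ s x : X) : V)))
    ((hcoe.tendsto _).comp hW) hs').and (h𝒲 (eventually_gt_atTop s))).exists
  have hnear : ∀ᶠ T in 𝓝 (t - s), Φ s x ≤ Φ T (Φ s x) := by
    refine (eventually_stronglyLT (tendsto_const_nhds (x := ((Φ s x : X) : V)))
      ((hcoe.tendsto _).comp (tendsto_flow (Φ := Φ) (tendsto_id (x := 𝓝 (t - s)))
        (tendsto_const_nhds (x := Φ s x)))) ?_).mono fun T hT => hT.le
    rw [← Φ.map_add, tsub_add_cancel_of_le hst.le]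
    exact ht
  have hsub := hmono.subsingleton_omegaSet (tsub_pos_of_lt hst) hnear
  have := hsub (omegaSet_subset_omegaSet_flow s x ha') (omegaSet_subset_omegaSet_flow s x hb')
  rw [this] at hs
  exact lt_irrefl _ hs.lt

/-- First alternative of the limit set dichotomy. A limit point `q` of `y` that is not one of `x`
is paired with some `p < q` in `ω(x)`; by connectedness of time, `p` and `q` stay ordered whatever
the relative delay, so `ω(p)` lies below `ω(q)`, and the two absorption principles apply. -/
theorem IsEventuallyStronglyMonotone.omegaSet_le_of_not_subset
    (hΦ : IsEventuallyStronglyMonotone Φ) (hB : ∀ x : X, HasPrecompactOrbit Φ x) {x y : X}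
    (hxy : x < y) (h : ¬ omegaSet Φ y ⊆ omegaSet Φ x) :
    ∀ a ∈ omegaSet Φ x, ∀ b ∈ omegaSet Φ y, a ≤ b := by
  obtain ⟨q, hq, hqx⟩ := not_subset.1 h
  obtain ⟨𝒰, h𝒰, hUq⟩ := mem_omegaSet_iff.1 hq
  obtain ⟨p, hUp⟩ := (hB x).exists_tendsto 𝒰
  have hp : p ∈ omegaSet Φ x := mem_omegaSet_iff.2 ⟨𝒰, h𝒰, hUp⟩
  have hpq : p < q := by
    refine (hΦ.1.le_of_tendsto hxy.le hUp hUq).lt_of_ne ?_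
    rintro rfl
    exact hqx hp
  have hcont : ∀ z : X, Continuous fun h => Φ h z := fun z =>
    Φ.continuous continuous_id continuous_const
  have h1 : ∀ h, Φ h p ≤ q := by
    have hcl : IsClopen {h | Φ h p ≤ q} := by
      refine ⟨isClosed_le (hcont p) continuous_const, isOpen_iff_mem_nhds.2 fun h hh => ?_⟩
      have hlt : Φ h p < Φ 0 q := by
        rw [Φ.map_zero_apply]
        refine lt_of_le_of_ne hh ?_
        rintro rfl
        exact hqx (flow_mem_omegaSet hp h)
      have ha : Tendsto (fun h : ℝ≥0 => (h, (0 : ℝ≥0))) (𝓝 h) (𝓝 (h, 0)) :=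
        Continuous.tendsto (by fun_prop) _
      filter_upwards [ha.eventually (hΦ.eventually_flow_le_of_lt h𝒰 hUp hUq hlt)] with h' hh'
      simpa using hh'
    have := hcl.eq_univ ⟨0, by simpa using hpq.le⟩
    exact fun h => (this ▸ mem_univ h : h ∈ {h | Φ h p ≤ q})
  have h2 : ∀ k, p ≤ Φ k q := by
    have hcl : IsClopen {k | p ≤ Φ k q} := by
      refine ⟨isClosed_le continuous_const (hcont q), isOpen_iff_mem_nhds.2 fun k hk => ?_⟩
      have hlt : Φ 0 p < Φ k q := by
        rw [Φ.map_zero_apply]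
        refine lt_of_le_of_ne hk fun heq => ?_
        have : p ∈ omegaSet Φ y := heq ▸ flow_mem_omegaSet hq k
        exact hΦ.not_lt_of_mem_omegaSet this hq hpq
      have ha : Tendsto (fun h : ℝ≥0 => ((0 : ℝ≥0), h)) (𝓝 k) (𝓝 (0, k)) :=
        Continuous.tendsto (by fun_prop) _
      filter_upwards [ha.eventually (hΦ.eventually_flow_le_of_lt h𝒰 hUp hUq hlt)] with h' hh'
      simpa using hh'
    have := hcl.eq_univ ⟨0, by simpa using hpq.le⟩
    exact fun h => (this ▸ mem_univ h : h ∈ {k | p ≤ Φ k q})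
  have h3 : ∀ h k, Φ h p ≤ Φ k q := by
    intro h k
    rcases le_total h k with hk | hk
    · have := hΦ.1 h _ _ (h2 (k - h))
      rwa [← Φ.map_add, add_tsub_cancel_of_le hk] at this
    · have := hΦ.1 k _ _ (h1 (h - k))
      rwa [← Φ.map_add, add_tsub_cancel_of_le hk] at this
  have h4 : ∀ e ∈ omegaSet Φ p, ∀ k, e ≤ Φ k q := by
    intro e he k
    obtain ⟨𝒲, -, hW⟩ := mem_omegaSet_iff.1 he
    exact le_of_tendsto' hW fun h => h3 h k
  have h5 : ∀ e ∈ omegaSet Φ p, ∀ f ∈ omegaSet Φ q, e < f := by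
    intro e he f hf
    have hle : e ≤ f := by
      obtain ⟨𝒲, -, hW⟩ := mem_omegaSet_iff.1 hf
      exact ge_of_tendsto' hW (h4 e he)
    refine lt_of_le_of_ne hle ?_
    rintro rfl
    have hle' : e ≤ q := by simpa using h4 e he 0
    rcases hle'.eq_or_lt with rfl | hlt
    · exact hqx (omegaSet_subset hp he)
    · exact hΦ.not_lt_of_mem_omegaSet (omegaSet_subset hq hf) hq hlt
  obtain ⟨e, he⟩ := (hB p).omegaSet_nonempty
  obtain ⟨f, hf⟩ := (hB q).omegaSet_nonempty
  have hex := omegaSet_subset hp he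
  have h6 := hΦ.omegaSet_le_of_lt_left (hB q) hex (h5 e he)
  refine hΦ.omegaSet_le_of_lt_right (hB x) (omegaSet_subset hq hf) fun a ha => ?_
  refine lt_of_le_of_ne (h6 a ha f hf) ?_
  rintro rfl
  exact hΦ.not_lt_of_mem_omegaSet hex ha (h5 e he _ hf)

/-- Second alternative of the limit set dichotomy: the two orbits are asymptotic, and their common
limit points are equilibria. Simultaneous limit points are ordered and both lie in the unordered set
`ω(x)`, so they coincide. -/
theorem IsEventuallyStronglyMonotone.exists_tendsto_of_subset
    (hΦ : IsEventuallyStronglyMonotone Φ) (hB : ∀ x : X, HasPrecompactOrbit Φ x) {x y : X}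
    (hxy : x < y) (h : omegaSet Φ y ⊆ omegaSet Φ x) {𝒰 : Ultrafilter ℝ≥0}
    (h𝒰 : (𝒰 : Filter ℝ≥0) ≤ atTop) :
    ∃ p ∈ equilibria Φ, Tendsto (fun t => Φ t x) 𝒰 (𝓝 p) ∧ Tendsto (fun t => Φ t y) 𝒰 (𝓝 p) := by
  obtain ⟨p, hp⟩ := (hB x).exists_tendsto 𝒰
  obtain ⟨q, hq⟩ := (hB y).exists_tendsto 𝒰
  have hle := hΦ.1.le_of_tendsto hxy.le hp hq
  have hpq : p = q := by
    by_contra hne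
    exact hΦ.not_lt_of_mem_omegaSet (mem_omegaSet_iff.2 ⟨𝒰, h𝒰, hp⟩)
      (h (mem_omegaSet_iff.2 ⟨𝒰, h𝒰, hq⟩)) (lt_of_le_of_ne hle hne)
  subst hpq
  exact ⟨p, hΦ.mem_equilibria h𝒰 hxy hp hq, hp, hq⟩

end Dichotomy

/-! ### Derivatives of the semiflow on order-convex sets -/

section Derivative

variable {V : Type*} [NormedAddCommGroup V] [NormedSpace ℝ V] {X : Set V} {Φ : Flow ℝ≥0 X}
  {t₀ : ℝ≥0} {D : ℝ≥0 → X → V →L[ℝ] V}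

/-- The chain rule. Derivatives relative to `X` need not be unique at a boundary point, but their
continuity carries the chain rule over from the interior. -/
theorem IsCompactC1From.deriv_add (hD : IsCompactC1From Φ t₀ D) {t s : ℝ≥0} (ht : t₀ ≤ t)
    (hs : t₀ ≤ s) {e : X} (he : e ∈ closure ((↑) ⁻¹' interior X : Set X)) :
    D (t + s) e = D t (Φ s e) * D s e := by
  have hts : t₀ ≤ t + s := ht.trans le_self_add
  have hcl : IsClosed {p : X | D (t + s) p = D t (Φ s p) * D s p} :=
    isClosed_eq (hD.continuous_deriv _ hts)
      (((hD.continuous_deriv t ht).comp (Φ.continuous continuous_const continuous_id)).mul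
        (hD.continuous_deriv s hs))
  refine closure_minimal (fun p hp => ?_) hcl he
  have hnhds : X ∈ 𝓝 (p : V) := mem_interior_iff_mem_nhds.1 hp
  have hmaps : MapsTo (timeMap Φ s) X X := fun q hq => by
    rw [show q = ((⟨q, hq⟩ : X) : V) from rfl, timeMap_coe]
    exact Subtype.coe_prop _
  have h1 := hD.hasFDeriv t ht (Φ s p)
  rw [← timeMap_coe] at h1
  have h2 := (h1.comp (p : V) (hD.hasFDeriv s hs p) hmaps).hasFDerivAt hnhds
  have h3 := (hD.hasFDeriv (t + s) hts p).hasFDerivAt hnhds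
  refine h3.unique (h2.congr_of_eventuallyEq ?_)
  filter_upwards [hnhds] with q hq
  rw [show q = ((⟨q, hq⟩ : X) : V) from rfl, Function.comp_apply, timeMap_coe, timeMap_coe,
    timeMap_coe, Φ.map_add]

theorem IsCompactC1From.deriv_add_of_mem_equilibria (hD : IsCompactC1From Φ t₀ D) {t s : ℝ≥0}
    (ht : t₀ ≤ t) (hs : t₀ ≤ s) {e : X} (he : e ∈ closure ((↑) ⁻¹' interior X : Set X))
    (heq : e ∈ equilibria Φ) : D (t + s) e = D t e * D s e := by
  rw [hD.deriv_add ht hs he, mem_equilibria_iff.1 heq]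

theorem IsCompactC1From.deriv_add_nsmul (hD : IsCompactC1From Φ t₀ D) {t s : ℝ≥0}
    (ht : t₀ ≤ t) (hs : t₀ ≤ s) {e : X} (he : e ∈ closure ((↑) ⁻¹' interior X : Set X))
    (heq : e ∈ equilibria Φ) (n : ℕ) : D (t + n • s) e = D t e * D s e ^ n := by
  induction n with
  | zero => simp
  | succ n ih =>
    rw [succ_nsmul, ← add_assoc,
      hD.deriv_add_of_mem_equilibria (ht.trans le_self_add) hs he heq, ih, pow_succ, mul_assoc]

/-- Fixed points `u` of `Φ t` that tend to `e` do so in a direction fixed by the derivative. -/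
theorem IsCompactC1From.exists_tendsto_direction (hD : IsCompactC1From Φ t₀ D) {t : ℝ≥0}
    (ht : t₀ ≤ t) {e : X} (he : Φ t e = e) {𝒰 : Ultrafilter X} (h𝒰 : (𝒰 : Filter X) ≤ 𝓝 e)
    (hne : ∀ᶠ u in 𝒰, u ≠ e) (hfix : ∀ᶠ u in 𝒰, Φ t u = u) :
    ∃ w : V, ‖w‖ = 1 ∧ D t e w = w ∧
      Tendsto (fun u : X => ‖(u : V) - e‖⁻¹ • ((u : V) - e)) 𝒰 (𝓝 w) := by
  set d : X → V := fun u => ‖(u : V) - e‖⁻¹ • ((u : V) - e) with hd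
  have hd1 : ∀ᶠ u in 𝒰, ‖d u‖ = 1 := by
    filter_upwards [hne] with u hu
    have : ‖(u : V) - e‖ ≠ 0 := by
      rw [norm_ne_zero_iff, sub_ne_zero]
      exact fun h => hu (Subtype.ext h)
    rw [hd, norm_smul, norm_inv, norm_norm, inv_mul_cancel₀ this]
  obtain ⟨w, hw⟩ := exists_tendsto_of_isCompactOperator (hD.compact_deriv t ht e)
    (𝒰 := 𝒰) (u := d) (C := 1) (hd1.mono fun u hu => hu.le)
  have hcoe : Tendsto ((↑) : X → V) 𝒰 (𝓝[X] e) := by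
    refine tendsto_nhdsWithin_iff.2 ⟨?_, Eventually.of_forall fun u => u.2⟩
    exact (continuous_subtype_val.tendsto e).mono_left h𝒰
  have h1 := (hasFDerivWithinAt_iff_tendsto.1 (hD.hasFDeriv t ht e)).comp hcoe
  have h2 : Tendsto (fun u => d u - D t e (d u)) 𝒰 (𝓝 0) := by
    refine tendsto_zero_iff_norm_tendsto_zero.2 (h1.congr' ?_)
    filter_upwards [hfix] with u hu
    rw [Function.comp_apply, timeMap_coe, timeMap_coe, hu, he, hd, map_smul, ← smul_sub, norm_smul,
      norm_inv, norm_norm]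
  have h3 : Tendsto d 𝒰 (𝓝 w) := by
    have := h2.add hw
    simpa using this
  refine ⟨w, ?_, ?_, h3⟩
  · exact tendsto_nhds_unique h3.norm (tendsto_const_nhds.congr' (hd1.mono fun u hu => hu.symm))
  · exact tendsto_nhds_unique (((D t e).continuous.tendsto w).comp h3) hw

variable [PartialOrder V] [IsOrderedAddMonoid V] [IsOrderedModule ℝ V]

theorem mem_interior_of_stronglyLT (hXo : X.OrdConnected) {x y : V} (hx : x ∈ X)
    (hy : y ∈ X) (h : StronglyLT x y) : (2⁻¹ : ℝ) • (x + y) ∈ interior X := by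
  have hopen : IsOpen {p : V | StronglyLT x p ∧ StronglyLT p y} :=
    (isOpen_setOf_stronglyLT.preimage (by fun_prop : Continuous fun p : V => (x, p))).inter
      (isOpen_setOf_stronglyLT.preimage (by fun_prop : Continuous fun p : V => (p, y)))
  refine mem_interior.2 ⟨_, fun p hp => hXo.out hx hy ⟨hp.1.le, hp.2.le⟩, hopen, ?_⟩
  have h0 : StronglyLT 0 (y - x) := by simpa [StronglyLT] using h
  have h2 := h0.smul (c := 2⁻¹) (by norm_num)
  constructor
  · have : (2⁻¹ : ℝ) • (x + y) - x = (2⁻¹ : ℝ) • (y - x) - 0 := by module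
    change _ ∈ _
    rw [this]
    exact h2
  · have : y - (2⁻¹ : ℝ) • (x + y) = (2⁻¹ : ℝ) • (y - x) - 0 := by module
    change _ ∈ _
    rw [this]
    exact h2

/-- A common limit of strongly ordered pairs of points of an order-convex set `X` is approached
from within `X` by interior points of `X`. -/
theorem mem_closure_interior (hXo : X.OrdConnected) {ι : Type*} {l : Filter ι} [l.NeBot]
    {a b : ι → X} {e : X} (ha : Tendsto a l (𝓝 e)) (hb : Tendsto b l (𝓝 e))
    (h : ∀ᶠ i in l, StronglyLT (a i : V) (b i)) :
    e ∈ closure ((↑) ⁻¹' interior X : Set X) := by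
  rw [closure_subtype]
  have hcoe : Continuous ((↑) : X → V) := continuous_subtype_val
  have hlim : Tendsto (fun i => (2⁻¹ : ℝ) • ((a i : V) + b i)) l (𝓝 (e : V)) := by
    have h1 := (((hcoe.tendsto _).comp ha).add ((hcoe.tendsto _).comp hb)).const_smul (2⁻¹ : ℝ)
    have h2 : (2⁻¹ : ℝ) • ((e : V) + e) = e := by
      rw [smul_add, ← add_smul]; norm_num
    rw [h2] at h1
    exact h1
  refine mem_closure_of_tendsto hlim ?_
  filter_upwards [h] with i hi
  have hm := mem_interior_of_stronglyLT hXo (a i).2 (b i).2 hi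
  exact ⟨⟨_, interior_subset hm⟩, hm, rfl⟩

theorem IsEventuallyStronglyMonotone.mem_closure_interior_of_tendsto
    (hΦ : IsEventuallyStronglyMonotone Φ) (hXo : X.OrdConnected) {𝒰 : Ultrafilter ℝ≥0}
    (h𝒰 : (𝒰 : Filter ℝ≥0) ≤ atTop) {x y e : X} (hxy : x < y)
    (hx : Tendsto (fun t => Φ t x) 𝒰 (𝓝 e)) (hy : Tendsto (fun t => Φ t y) 𝒰 (𝓝 e)) :
    e ∈ closure ((↑) ⁻¹' interior X : Set X) := by
  obtain ⟨t₁, ht₁⟩ := hΦ.2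
  exact mem_closure_interior hXo hx hy
    (h𝒰 ((eventually_ge_atTop t₁).mono fun t ht => ht₁ x y hxy t ht))

variable [OrderClosedTopology V]

/-- A curve whose derivative lies in the order cone increases. -/
theorem le_of_hasDerivWithinAt_nonneg {φ φ' : ℝ → V} {g : ℝ} (hg : 0 ≤ g)
    (hφ : ∀ s ∈ Icc 0 g, HasDerivWithinAt φ (φ' s) (Icc 0 g) s) (hφ' : ∀ s ∈ Icc 0 g, 0 ≤ φ' s) :
    φ 0 ≤ φ g := by
  by_contra hcon
  have hx : φ g - φ 0 ∉ Ici (0 : V) := fun h => hcon (sub_nonneg.1 h)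
  obtain ⟨f, u, hfu, hf⟩ := geometric_hahn_banach_point_closed (convex_Ici (𝕜 := ℝ) (0 : V))
    isClosed_Ici hx
  have hu : u < 0 := by simpa using hf 0 self_mem_Ici
  have hfpos : ∀ b : V, 0 ≤ b → 0 ≤ f b := by
    intro b hb
    by_contra! hneg
    have h1 := hf ((u / f b) • b) (smul_nonneg (div_nonneg_of_nonpos hu.le hneg.le) hb)
    rw [map_smul, smul_eq_mul, div_mul_cancel₀ _ hneg.ne] at h1
    exact lt_irrefl _ h1
  have hfφ : ∀ s ∈ Icc 0 g, HasDerivWithinAt (fun s => f (φ s)) (f (φ' s)) (Icc 0 g) s :=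
    fun s hs => f.hasFDerivAt.comp_hasDerivWithinAt s (hφ s hs)
  have hmono : MonotoneOn (fun s => f (φ s)) (Icc 0 g) := by
    refine monotoneOn_of_hasDerivWithinAt_nonneg (convex_Icc 0 g)
      (fun s hs => (hfφ s hs).continuousWithinAt)
      (fun s hs => (hfφ s (interior_subset hs)).mono interior_subset)
      (fun s hs => hfpos _ (hφ' s (interior_subset hs)))
  have h1 : f (φ 0) ≤ f (φ g) := hmono (left_mem_Icc.2 hg) (right_mem_Icc.2 hg) hg
  rw [map_sub] at hfu
  linarith

theorem IsCompactC1From.apply_nonneg_of_mem_interior (hD : IsCompactC1From Φ t₀ D)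
    (hΦ : IsMonotone Φ) {t : ℝ≥0} (ht : t₀ ≤ t) {p : X} (hp : (p : V) ∈ interior X) {u : V}
    (hu : 0 ≤ u) : 0 ≤ D t p u := by
  have hnhds : X ∈ 𝓝 (p : V) := mem_interior_iff_mem_nhds.1 hp
  have h1 : HasFDerivAt (timeMap Φ t) (D t p) p := (hD.hasFDeriv t ht p).hasFDerivAt hnhds
  have h2 : HasDerivAt (fun s : ℝ => timeMap Φ t ((p : V) + s • u)) (D t p u) 0 :=
    h1.hasLineDerivAt u
  rw [hasDerivAt_iff_tendsto_slope] at h2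
  have h3 := h2.mono_left (nhdsWithin_mono (0 : ℝ) fun s (hs : s ∈ Ioi 0) => hs.ne')
  refine ge_of_tendsto h3 ?_
  have hcont : Tendsto (fun s : ℝ => (p : V) + s • u) (𝓝[>] 0) (𝓝 p) := by
    have : Tendsto (fun s : ℝ => (p : V) + s • u) (𝓝 0) (𝓝 ((p : V) + (0 : ℝ) • u)) :=
      Continuous.tendsto (by fun_prop) _
    rw [zero_smul, add_zero] at this
    exact this.mono_left nhdsWithin_le_nhds
  filter_upwards [hcont.eventually hnhds, self_mem_nhdsWithin] with s hs (hs0 : 0 < s)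
  rw [slope_def_module, sub_zero, zero_smul, add_zero]
  refine smul_nonneg (inv_nonneg.2 hs0.le) (sub_nonneg.2 ?_)
  rw [timeMap_coe, show (p : V) + s • u = ((⟨_, hs⟩ : X) : V) from rfl, timeMap_coe]
  refine hΦ t _ _ ?_
  exact le_add_of_nonneg_right (smul_nonneg hs0.le hu)

theorem IsCompactC1From.apply_nonneg (hD : IsCompactC1From Φ t₀ D)
    (hΦ : IsMonotone Φ) {t : ℝ≥0} (ht : t₀ ≤ t) {e : X}
    (he : e ∈ closure ((↑) ⁻¹' interior X : Set X)) {u : V} (hu : 0 ≤ u) : 0 ≤ D t e u := by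
  have hcl : IsClosed {p : X | 0 ≤ D t p u} :=
    isClosed_le continuous_const ((hD.continuous_deriv t ht).clm_apply continuous_const)
  exact closure_minimal (fun p hp => hD.apply_nonneg_of_mem_interior hΦ ht hp hu) hcl he

/-- Near a point `e` with `v ≪ Φ_T'(e) v`, the map `Φ T` does not decrease the lower bounds `g • v`
for differences of ordered points. -/
theorem IsCompactC1From.exists_forall_add_smul_le (hD : IsCompactC1From Φ t₀ D)
    (hΦ : IsMonotone Φ) (hXo : X.OrdConnected) {v : V} (hv : 0 ≤ v) {T : ℝ≥0} (hT : t₀ ≤ T) {e : X}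
    (he : StronglyLT v (D T e v)) :
    ∃ δ : ℝ, 0 < δ ∧ ∀ u : X, dist u e < δ → ∀ g : ℝ, 0 < g → g < δ →
      ∀ u' : X, (u : V) + g • v ≤ u' → (Φ T u : V) + g • v ≤ Φ T u' := by
  have h1 : ∀ᶠ p in 𝓝 e, StronglyLT v (D T p v) :=
    eventually_stronglyLT tendsto_const_nhds
      (((hD.continuous_deriv T hT).clm_apply continuous_const).tendsto e) he
  obtain ⟨r, hr, hrp⟩ := Metric.eventually_nhds_iff.1 h1
  refine ⟨r / (1 + ‖v‖), by positivity, fun u hu g hg hgr u' hu' => ?_⟩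
  have hmem : ∀ s ∈ Icc 0 g, (u : V) + s • v ∈ X := fun s hs =>
    hXo.out u.2 u'.2 ⟨le_add_of_nonneg_right (smul_nonneg hs.1 hv),
      (add_le_add_right (smul_le_smul_of_nonneg_right hs.2 hv) _).trans hu'⟩
  have hnear : ∀ s (hs : s ∈ Icc 0 g), dist (⟨(u : V) + s • v, hmem s hs⟩ : X) e < r := by
    intro s hs
    have h2 : ‖s • v‖ ≤ g * ‖v‖ := by
      rw [norm_smul, Real.norm_of_nonneg hs.1]
      exact mul_le_mul_of_nonneg_right hs.2 (norm_nonneg v)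
    have h3 : ‖(u : V) - e‖ < r / (1 + ‖v‖) := by rwa [← dist_eq_norm]
    rw [Subtype.dist_eq, dist_eq_norm]
    calc ‖(u : V) + s • v - e‖ = ‖((u : V) - e) + s • v‖ := by congr 1; abel
      _ ≤ ‖(u : V) - e‖ + ‖s • v‖ := norm_add_le _ _
      _ < r / (1 + ‖v‖) + r / (1 + ‖v‖) * ‖v‖ :=
        add_lt_add_of_lt_of_le h3 (h2.trans (by gcongr))
      _ = r := by field_simp
  let φ : ℝ → V := fun s => timeMap Φ T ((u : V) + s • v) - s • v
  classical
  let φ' : ℝ → V := fun s =>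
    if hs : s ∈ Icc 0 g then D T ⟨(u : V) + s • v, hmem s hs⟩ v - v else 0
  have hφ : ∀ s ∈ Icc 0 g, HasDerivWithinAt φ (φ' s) (Icc 0 g) s := by
    intro s hs
    simp only [φ', dif_pos hs]
    have h2 : HasDerivWithinAt (fun s : ℝ => (u : V) + s • v) v (Icc 0 g) s := by
      have := ((hasDerivAt_id s).smul_const v).const_add (u : V)
      rw [one_smul] at this
      exact this.hasDerivWithinAt
    have h3 : HasDerivWithinAt (fun s : ℝ => s • v) v (Icc 0 g) s := by
      have := (hasDerivAt_id s).smul_const v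
      rw [one_smul] at this
      exact this.hasDerivWithinAt
    have h4 := hD.hasFDeriv T hT ⟨(u : V) + s • v, hmem s hs⟩
    exact (h4.comp_hasDerivWithinAt s h2 hmem).sub h3
  have h5 := le_of_hasDerivWithinAt_nonneg hg.le hφ (fun s hs => by
    simp only [φ', dif_pos hs]
    exact sub_nonneg.2 (hrp (hnear s hs)).le)
  have hgm : (g : ℝ) ∈ Icc 0 g := right_mem_Icc.2 hg.le
  simp only [φ, zero_smul, add_zero, sub_zero, timeMap_coe] at h5
  rw [show (u : V) + g • v = ((⟨_, hmem g hgm⟩ : X) : V) from rfl, timeMap_coe, le_sub_iff_add_le]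
    at h5
  exact h5.trans (hΦ T _ _ hu')

/-- If at every limit point `e` of `x` some derivative satisfies `v ≪ Φ_T'(e) v`, then no orbit
above that of `x` can be asymptotic to it. -/
theorem IsCompactC1From.false_of_expanding [Nontrivial V] (hD : IsCompactC1From Φ t₀ D)
    (hΦ : IsEventuallyStronglyMonotone Φ) (hXo : X.OrdConnected)
    (hB : ∀ x : X, HasPrecompactOrbit Φ x) {v : V} (hv : StronglyLT 0 v) {x y : X} (hxy : x < y)
    (hlim : ∀ 𝒰 : Ultrafilter ℝ≥0, (𝒰 : Filter ℝ≥0) ≤ atTop →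
      ∃ p, Tendsto (fun t => Φ t x) 𝒰 (𝓝 p) ∧ Tendsto (fun t => Φ t y) 𝒰 (𝓝 p))
    (hexp : ∀ e ∈ omegaSet Φ x, ∃ T : ℝ≥0, 0 < T ∧ t₀ ≤ T ∧ StronglyLT v (D T e v)) : False := by
  -- a neighbourhood `U` of `ω(x)` with uniform bounds
  have hU : ∃ U : Set X, IsOpen U ∧ omegaSet Φ x ⊆ U ∧ ∃ δ : ℝ, 0 < δ ∧ ∃ τ : ℝ≥0, 0 < τ ∧
      ∀ u ∈ U, ∀ g : ℝ, 0 < g → g < δ → ∃ T, τ ≤ T ∧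
        ∀ u' : X, (u : V) + g • v ≤ u' → (Φ T u : V) + g • v ≤ Φ T u' := by
    refine (hB x).isCompact_omegaSet.induction_on
      (p := fun s => ∃ U : Set X, IsOpen U ∧ s ⊆ U ∧ ∃ δ : ℝ, 0 < δ ∧ ∃ τ : ℝ≥0, 0 < τ ∧
        ∀ u ∈ U, ∀ g : ℝ, 0 < g → g < δ → ∃ T, τ ≤ T ∧
          ∀ u' : X, (u : V) + g • v ≤ u' → (Φ T u : V) + g • v ≤ Φ T u') ?_ ?_ ?_ ?_
    · exact ⟨∅, isOpen_empty, subset_rfl, 1, one_pos, 1, one_pos, fun u hu => hu.elim⟩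
    · rintro s s' hss ⟨U, hU, hsU, h⟩
      exact ⟨U, hU, hss.trans hsU, h⟩
    · rintro s s' ⟨U, hU, hsU, δ, hδ, τ, hτ, h⟩ ⟨U', hU', hsU', δ', hδ', τ', hτ', h'⟩
      refine ⟨U ∪ U', hU.union hU', union_subset_union hsU hsU', min δ δ', lt_min hδ hδ',
        min τ τ', lt_min hτ hτ', ?_⟩
      rintro u (hu | hu) g hg hgδ
      · obtain ⟨T, hT, hT'⟩ := h u hu g hg (hgδ.trans_le (min_le_left _ _))
        exact ⟨T, (min_le_left _ _).trans hT, hT'⟩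
      · obtain ⟨T, hT, hT'⟩ := h' u hu g hg (hgδ.trans_le (min_le_right _ _))
        exact ⟨T, (min_le_right _ _).trans hT, hT'⟩
    · intro e he
      obtain ⟨T, hT0, hT, hTv⟩ := hexp e he
      obtain ⟨δ, hδ, h⟩ := hD.exists_forall_add_smul_le hΦ.1 hXo hv.le hT hTv
      refine ⟨Metric.ball e δ, mem_nhdsWithin_of_mem_nhds (Metric.ball_mem_nhds e hδ),
        Metric.ball e δ, Metric.isOpen_ball, subset_rfl, δ, hδ, T, hT0, fun u hu g hg hgδ =>
          ⟨T, le_rfl, h u hu g hg hgδ⟩⟩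
  obtain ⟨U, hUo, hUω, δ, hδ, τ, hτ, hstep⟩ := hU
  have hin : ∀ᶠ t in atTop, Φ t x ∈ U := by
    by_contra hcon
    obtain ⟨𝒲, h𝒲, hW⟩ := exists_ultrafilter_of_frequently (not_eventually.1 hcon)
    obtain ⟨p, hp⟩ := (hB x).exists_tendsto 𝒲
    obtain ⟨t, ht, ht'⟩ := ((hp.eventually (hUo.mem_nhds
      (hUω (mem_omegaSet_iff.2 ⟨𝒲, h𝒲, hp⟩)))).and hW).exists
    exact ht' ht
  obtain ⟨N, hN⟩ := eventually_atTop.1 hin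
  obtain ⟨t₁, ht₁⟩ := hΦ.2
  have hs := ht₁ x y hxy (max t₁ N) (le_max_left _ _)
  have hs0 : StronglyLT 0 ((Φ (max t₁ N) y : V) - Φ (max t₁ N) x) := by
    simpa [StronglyLT] using hs
  obtain ⟨ε, hε, hεv⟩ := hs0.exists_smul_le v
  obtain ⟨g, hg, hgm⟩ := exists_between (lt_min hε hδ)
  have hstart : (Φ (max t₁ N) x : V) + g • v ≤ Φ (max t₁ N) y := by
    have h1 : g • v ≤ ε • v :=
      smul_le_smul_of_nonneg_right (hgm.trans_le (min_le_left _ _)).le hv.le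
    rw [add_comm]
    exact le_sub_iff_add_le.1 (h1.trans hεv)
  have hall : ∀ n : ℕ, ∃ t, N + n • τ ≤ t ∧ (Φ t x : V) + g • v ≤ Φ t y := by
    intro n
    induction n with
    | zero => exact ⟨max t₁ N, by simp, hstart⟩
    | succ n ih =>
      obtain ⟨t, ht, hle⟩ := ih
      obtain ⟨T, hT, hT'⟩ := hstep _ (hN t (le_self_add.trans ht)) g hg
        (hgm.trans_le (min_le_right _ _))
      refine ⟨T + t, ?_, ?_⟩
      · rw [succ_nsmul, ← add_assoc, add_comm T]
        exact add_le_add ht hT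
      · rw [Φ.map_add, Φ.map_add]
        exact hT' _ hle
  have hfreq : ∃ᶠ t in atTop, (Φ t x : V) + g • v ≤ Φ t y := by
    rw [frequently_atTop]
    intro b
    obtain ⟨n, hn⟩ := exists_nat_ge (b / τ)
    obtain ⟨t, ht, hle⟩ := hall n
    refine ⟨t, le_trans ?_ ht, hle⟩
    rw [div_le_iff₀ hτ, ← nsmul_eq_mul] at hn
    exact hn.trans le_add_self
  obtain ⟨𝒰, h𝒰, hU⟩ := exists_ultrafilter_of_frequently hfreq
  obtain ⟨p, hpx, hpy⟩ := hlim 𝒰 h𝒰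
  have hcoe : Continuous ((↑) : X → V) := continuous_subtype_val
  have h1 : (p : V) + g • v ≤ p := le_of_tendsto_of_tendsto
    (((hcoe.tendsto _).comp hpx).add_const _) ((hcoe.tendsto _).comp hpy) hU
  exact absurd (hv.smul hg).lt (not_lt_of_ge (by simpa using h1))

end Derivative

/-! ### Stability of the equilibria that attract ordered points -/

section Stability

variable {V : Type*} [NormedAddCommGroup V] [NormedSpace ℝ V] [PartialOrder V]
  [IsOrderedAddMonoid V] [IsOrderedModule ℝ V] [OrderClosedTopology V]
  {X : Set V} {Φ : Flow ℝ≥0 X} {t₀ : ℝ≥0} {D : ℝ≥0 → X → V →L[ℝ] V}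

/-- At an irreducible equilibrium, instability at one time gives expansion of `v` at another. -/
theorem IsCompactC1From.exists_stronglyLT_apply (hD : IsCompactC1From Φ t₀ D) (hΦ : IsMonotone Φ)
    {e : X} (he : e ∈ closure ((↑) ⁻¹' interior X : Set X)) (heq : e ∈ equilibria Φ)
    (hirr : IsIrreducibleAt t₀ D e) {v : V} (hv : StronglyLT 0 v) {t : ℝ≥0} (ht : t₀ ≤ t)
    (hρ : 1 < specRadius (D t e)) :
    ∃ T : ℝ≥0, 0 < T ∧ t₀ ≤ T ∧ StronglyLT v (D T e v) := by
  obtain ⟨τ, hτ0, hτ, hP⟩ := hirr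
  obtain ⟨j, hj⟩ := exists_stronglyLT_apply_pow_apply (hD.compact_deriv t ht e)
    (fun u hu => hD.apply_nonneg hΦ ht he hu) hP hv hρ
  refine ⟨τ + j • t, hτ0.trans_le le_self_add, hτ.trans le_self_add, ?_⟩
  rw [hD.deriv_add_nsmul hτ ht he heq]
  exact hj

variable [Nontrivial V]

/-- The limit set dichotomy for nonconvergent points. In the second alternative `ω(x) = ω(y)` is a
nondegenerate unordered set of equilibria without isolated points. Its tangent directions are fixed
by strongly positive derivatives and not comparable to `0`, so all these equilibria are unstable,
and the orbits of `x` and `y` could not be asymptotic. -/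
theorem IsCompactC1From.omegaSet_le_of_not_convergent [CompleteSpace V]
    (hD : IsCompactC1From Φ t₀ D) (hΦ : IsEventuallyStronglyMonotone Φ) (hXo : X.OrdConnected)
    (hB : ∀ x : X, HasPrecompactOrbit Φ x)
    (hirr : ∀ e ∈ equilibria Φ, IsIrreducibleAt t₀ D e) {v : V} (hv : StronglyLT 0 v) {x y : X}
    (hxy : x < y) (hx : ¬ ∃ p, Tendsto (fun t => Φ t x) atTop (𝓝 p)) :
    ∀ a ∈ omegaSet Φ x, ∀ b ∈ omegaSet Φ y, a ≤ b := by
  by_cases hsub : omegaSet Φ y ⊆ omegaSet Φ x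
  swap
  · exact hΦ.omegaSet_le_of_not_subset hB hxy hsub
  exfalso
  have hlim := fun (𝒰 : Ultrafilter ℝ≥0) (h𝒰 : (𝒰 : Filter ℝ≥0) ≤ atTop) =>
    hΦ.exists_tendsto_of_subset hB hxy hsub h𝒰
  have hE : ∀ e ∈ omegaSet Φ x, e ∈ equilibria Φ ∧ e ∈ closure ((↑) ⁻¹' interior X : Set X) := by
    intro e he
    obtain ⟨𝒰, h𝒰, hU⟩ := mem_omegaSet_iff.1 he
    obtain ⟨p, hp, hpx, hpy⟩ := hlim 𝒰 h𝒰
    obtain rfl := tendsto_nhds_unique hU hpx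
    exact ⟨hp, hΦ.mem_closure_interior_of_tendsto hXo h𝒰 hxy hpx hpy⟩
  refine hD.false_of_expanding hΦ hXo hB hv hxy
    (fun 𝒰 h𝒰 => (hlim 𝒰 h𝒰).imp fun p hp => hp.2) fun e he => ?_
  obtain ⟨heq, hcl⟩ := hE e he
  obtain ⟨τ, hτ0, hτ, hP⟩ := hirr e heq
  refine hD.exists_stronglyLT_apply hΦ.1 hcl heq (hirr e heq) hv hτ ?_
  obtain ⟨e', he', hne⟩ : ∃ e' ∈ omegaSet Φ x, e' ≠ e := by
    by_contra! h
    exact hx ⟨e, (hB x).tendsto h⟩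
  have hdist : 0 < dist e e' := dist_pos.2 hne.symm
  have hfreq : ∃ᶠ u in 𝓝 e, u ∈ omegaSet Φ x ∧ u ≠ e := by
    rw [Metric.nhds_basis_ball.frequently_iff]
    intro r hr
    obtain ⟨s, hs0, hs⟩ := exists_between (lt_min hr hdist)
    obtain ⟨u, hu, hus⟩ := (hB x).exists_mem_omegaSet_dist_eq he he' hs0
      (hs.trans_le (min_le_right _ _))
    refine ⟨u, ?_, hu, ?_⟩
    · rw [Metric.mem_ball, hus]
      exact hs.trans_le (min_le_left _ _)
    · rintro rfl
      rw [dist_self] at hus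
      exact hs0.ne hus
  obtain ⟨𝒰, h𝒰, hU⟩ := exists_ultrafilter_of_frequently hfreq
  obtain ⟨w, hw1, hDw, hw⟩ := hD.exists_tendsto_direction hτ (mem_equilibria_iff.1 heq τ) h𝒰
    (hU.mono fun u hu => hu.2) (hU.mono fun u hu => mem_equilibria_iff.1 (hE u hu.1).1 τ)
  have hw0 : w ≠ 0 := by
    rintro rfl
    rw [norm_zero] at hw1
    exact zero_ne_one hw1
  refine one_lt_specRadius_of_apply_eq (hD.compact_deriv τ hτ e) hP hv hDw ?_ ?_
  · intro hwpos
    have h1 := hP w (lt_of_le_of_ne hwpos hw0.symm)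
    rw [hDw] at h1
    obtain ⟨u, hu, hu'⟩ := ((eventually_stronglyLT tendsto_const_nhds hw h1).and hU).exists
    have hnorm : 0 < ‖(u : V) - e‖ := norm_pos_iff.2 (sub_ne_zero.2 fun h => hu'.2 (Subtype.ext h))
    have h2 := hu.smul hnorm
    rw [smul_inv_smul₀ hnorm.ne'] at h2
    exact hΦ.not_lt_of_mem_omegaSet he hu'.1 (sub_pos.1 h2.lt : (e : V) < u)
  · intro hwneg
    have h1 := hP (-w) (lt_of_le_of_ne (neg_nonneg.2 hwneg) (neg_ne_zero.2 hw0).symm)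
    rw [map_neg, hDw] at h1
    obtain ⟨u, hu, hu'⟩ := ((eventually_stronglyLT tendsto_const_nhds hw.neg h1).and hU).exists
    have hnorm : 0 < ‖(u : V) - e‖ := norm_pos_iff.2 (sub_ne_zero.2 fun h => hu'.2 (Subtype.ext h))
    have h2 := hu.smul hnorm
    rw [smul_neg, smul_inv_smul₀ hnorm.ne', neg_sub] at h2
    exact hΦ.not_lt_of_mem_omegaSet hu'.1 he (sub_pos.1 h2.lt : (u : V) < e)

/-- An equilibrium attracting two ordered points is linearly or neutrally stable. -/
theorem IsCompactC1From.mem_stableEquilibria_of_tendsto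
    (hD : IsCompactC1From Φ t₀ D) (hΦ : IsEventuallyStronglyMonotone Φ) (hXo : X.OrdConnected)
    (hB : ∀ x : X, HasPrecompactOrbit Φ x)
    (hirr : ∀ e ∈ equilibria Φ, IsIrreducibleAt t₀ D e) {v : V} (hv : StronglyLT 0 v) {x y e : X}
    (hxy : x < y) (hx : Tendsto (fun t => Φ t x) atTop (𝓝 e))
    (hy : Tendsto (fun t => Φ t y) atTop (𝓝 e)) : e ∈ stableEquilibria Φ t₀ D := by
  have heq := mem_equilibria_of_tendsto hx
  obtain ⟨𝒰, h𝒰⟩ := exists_ultrafilter_le_atTop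
  have hcl := hΦ.mem_closure_interior_of_tendsto hXo h𝒰 hxy (hx.mono_left h𝒰) (hy.mono_left h𝒰)
  have hle : ∀ t, t₀ ≤ t → specRadius (D t e) ≤ 1 := by
    intro t ht
    by_contra! hρ
    refine hD.false_of_expanding hΦ hXo hB hv hxy
      (fun 𝒲 h𝒲 => ⟨e, hx.mono_left h𝒲, hy.mono_left h𝒲⟩) fun e' he' => ?_
    rw [omegaSet_eq_singleton hx, mem_singleton_iff] at he'
    subst he'
    exact hD.exists_stronglyLT_apply hΦ.1 hcl heq (hirr _ heq) hv ht hρ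
  refine ⟨heq, ?_⟩
  by_cases hstab : ∃ s, t₀ ≤ s ∧ specRadius (D s e) < 1
  · obtain ⟨s, hs, hρs⟩ := hstab
    refine Or.inl fun t ht0 ht => ?_
    -- some multiple of `t` exceeds `s` by an admissible time
    obtain ⟨n, hn⟩ := exists_nat_ge ((s + t₀) / t)
    rw [div_le_iff₀ ht0, ← nsmul_eq_mul] at hn
    have hsr : s ≤ t + n • t := le_self_add.trans (hn.trans le_add_self)
    obtain ⟨r, hr⟩ := exists_add_of_le hsr
    have hr0 : t₀ ≤ r := by
      have : s + t₀ ≤ s + r := by rw [← hr]; exact hn.trans le_add_self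
      exact le_of_add_le_add_left this
    refine specRadius_lt_one_of_pow_eq_mul (a := D s e) (b := D r e) n.succ_pos ?_ ?_ hρs
      (hle r hr0)
    · rw [← hD.deriv_add_of_mem_equilibria hs hr0 hcl heq, ← hr,
        hD.deriv_add_nsmul ht ht hcl heq, pow_succ']
    · rw [Commute, SemiconjBy, ← hD.deriv_add_of_mem_equilibria hs hr0 hcl heq,
        ← hD.deriv_add_of_mem_equilibria hr0 hs hcl heq, add_comm]
  · push Not at hstab
    exact Or.inr fun t _ ht => le_antisymm (hle t ht) (hstab t ht)

/-- An equilibrium that is approached from above by equilibria is neutrally stable. -/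
theorem IsCompactC1From.mem_stableEquilibria_of_accumulation
    (hD : IsCompactC1From Φ t₀ D) (hΦ : IsMonotone Φ) (hXo : X.OrdConnected)
    (hirr : ∀ e ∈ equilibria Φ, IsIrreducibleAt t₀ D e) {e : X} (heq : e ∈ equilibria Φ)
    (hacc : ∃ᶠ u in 𝓝 e, u ∈ equilibria Φ ∧ StronglyLT (e : V) u) :
    e ∈ stableEquilibria Φ t₀ D := by
  obtain ⟨𝒰, h𝒰, hU⟩ := exists_ultrafilter_of_frequently hacc
  have hcl : e ∈ closure ((↑) ⁻¹' interior X : Set X) :=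
    mem_closure_interior hXo (l := (𝒰 : Filter X)) tendsto_const_nhds h𝒰 (hU.mono fun u hu => hu.2)
  have hdir := fun (t : ℝ≥0) (ht : t₀ ≤ t) =>
    hD.exists_tendsto_direction ht (mem_equilibria_iff.1 heq t) h𝒰
      (hU.mono fun u hu h => by
        have := hu.2.lt
        rw [h] at this
        exact lt_irrefl _ this)
      (hU.mono fun u hu => mem_equilibria_iff.1 hu.1 t)
  obtain ⟨τ, hτ0, hτ, hP⟩ := hirr e heq
  obtain ⟨w, hw1, hDw, hw⟩ := hdir τ hτ
  have hw0 : w ≠ 0 := by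
    rintro rfl
    rw [norm_zero] at hw1
    exact zero_ne_one hw1
  have hwnonneg : 0 ≤ w := ge_of_tendsto hw (hU.mono fun u hu =>
    smul_nonneg (inv_nonneg.2 (norm_nonneg _)) (sub_nonneg.2 hu.2.le))
  have hwpos : StronglyLT 0 w := by
    have := hP w (lt_of_le_of_ne hwnonneg hw0.symm)
    rwa [hDw] at this
  refine ⟨heq, Or.inr fun t _ ht => ?_⟩
  obtain ⟨w', -, hDw', hw'⟩ := hdir t ht
  obtain rfl := tendsto_nhds_unique hw hw'
  refine le_antisymm (specRadius_le_one_of_apply_eq (hD.compact_deriv t ht e)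
    (fun u hu => hD.apply_nonneg hΦ ht hcl hu) hwpos hDw') (one_le_specRadius fun n => ?_)
  have hpow : (D t e ^ n) w = w := by
    induction n with
    | zero => simp
    | succ n ih => rw [pow_succ, mul_apply_eq_comp, hDw', ih]
  have := (D t e ^ n).le_opNorm w
  rwa [hpow, hw1, mul_one] at this

end Stability

/-! ### Shyness from countable intersections with parallel lines -/

section Shy

/-- In a second countable space, only countably many members of a family indexed by reals are not
accumulated by members of larger index: distinct such members pick distinct basic neighbourhoods. -/
theorem countable_setOf_right_isolated {β : Type*} [TopologicalSpace β]
    [SecondCountableTopology β] (f : ℝ → β) (T : Set ℝ) :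
    {s ∈ T | ∃ U ∈ 𝓝 (f s), ∀ s' ∈ T, s < s' → f s' ∉ U}.Countable := by
  have hB := TopologicalSpace.isBasis_countableBasis β
  have h : ∀ s ∈ {s ∈ T | ∃ U ∈ 𝓝 (f s), ∀ s' ∈ T, s < s' → f s' ∉ U},
      ∃ B ∈ TopologicalSpace.countableBasis β, f s ∈ B ∧ ∀ s' ∈ T, s < s' → f s' ∉ B := by
    rintro s ⟨-, U, hU, hs⟩
    obtain ⟨B, hB1, hB2, hB3⟩ := hB.mem_nhds_iff.1 hU
    exact ⟨B, hB1, hB2, fun s' hs' hlt hmem => hs s' hs' hlt (hB3 hmem)⟩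
  choose! B hB1 hB2 hB3 using h
  refine MapsTo.countable_of_injOn (f := B) hB1 ?_ (TopologicalSpace.countable_countableBasis β)
  intro s hs s' hs' heq
  rcases lt_trichotomy s s' with hlt | rfl | hlt
  · exact absurd (heq ▸ hB2 s' hs') (hB3 s hs s' hs'.1 hlt)
  · rfl
  · exact absurd (heq ▸ hB2 s hs) (hB3 s' hs' s hs.1 hlt)

/-- The measure used to test shyness is Lebesgue measure on the segment from `0` to `v`. -/
theorem isShy_of_countable_lines {V : Type*} [NormedAddCommGroup V] [NormedSpace ℝ V]
    [MeasurableSpace V] [BorelSpace V] {W S : Set V} (hWS : W ⊆ S) (hS : MeasurableSet S) (v : V)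
    (h : ∀ x, {s : ℝ | x + s • v ∈ S}.Countable) : IsShy W := by
  have hcont : Continuous fun s : ℝ => s • v := by fun_prop
  refine ⟨S, hWS, hS, (volume.restrict (Icc (0 : ℝ) 1)).map fun s => s • v, inferInstance, ?_,
    ⟨(fun s : ℝ => s • v) '' Icc 0 1, isCompact_Icc.image hcont, ?_⟩, fun x => ?_⟩
  · intro h0
    have h1 := congrArg (fun μ : Measure V => μ univ) h0
    simp [Measure.map_apply hcont.measurable MeasurableSet.univ] at h1
  · rw [Measure.map_apply hcont.measurable (isCompact_Icc.image hcont).measurableSet.compl,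
      preimage_compl, Measure.restrict_apply
        (hcont.measurable (isCompact_Icc.image hcont).measurableSet).compl]
    convert measure_empty (μ := (volume : Measure ℝ))
    ext s
    simp only [mem_inter_iff, mem_compl_iff, mem_preimage, mem_empty_iff_false, iff_false, not_and]
    exact fun hs hs' => hs ⟨s, hs', rfl⟩
  · have himage : (fun w => w + x) '' S = (fun w => w - x) ⁻¹' S := by
      ext w
      constructor
      · rintro ⟨y, hy, rfl⟩
        simpa using hy
      · intro hw
        exact ⟨w - x, hw, by simp⟩
    rw [himage, Measure.map_apply hcont.measurable
      ((by fun_prop : Continuous fun w : V => w - x).measurable hS)]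
    refine Measure.absolutelyContinuous_of_le Measure.restrict_le_self (Countable.measure_zero ?_ _)
    refine (h (-x)).mono fun s hs => ?_
    rw [mem_ofPred_eq, neg_add_eq_sub]
    exact hs

end Shy

/-! ### The Borel set of good points -/

section GoodPoints

variable {V : Type*} [NormedAddCommGroup V] {X : Set V}

theorem tendsto_flow_of_tendsto_nat {Φ : Flow ℝ≥0 X} {x e : X} (he : e ∈ equilibria Φ)
    (h : Tendsto (fun n : ℕ => Φ n x) atTop (𝓝 e)) : Tendsto (fun t => Φ t x) atTop (𝓝 e) := by
  rw [tendsto_iff_ultrafilter]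
  intro 𝒰 h𝒰
  obtain ⟨r, -, hr⟩ := (isCompact_Icc (a := (0 : ℝ≥0)) (b := 1)).ultrafilter_le_nhds'
    (𝒰.map fun t => t - ⌊t⌋₊) (by
      refine Ultrafilter.mem_map.2 (univ_mem' fun t => ?_)
      exact ⟨zero_le, tsub_le_iff_left.2 (Nat.lt_floor_add_one t).le⟩)
  have h1 : Tendsto (fun t : ℝ≥0 => Φ (⌊t⌋₊ : ℝ≥0) x) 𝒰 (𝓝 e) :=
    (h.comp tendsto_nat_floor_atTop).mono_left h𝒰
  have h2 := tendsto_flow (Φ := Φ) (show Tendsto (fun t : ℝ≥0 => t - ⌊t⌋₊) 𝒰 (𝓝 r) from hr) h1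
  rw [mem_equilibria_iff.1 he] at h2
  refine h2.congr fun t => ?_
  rw [← Φ.map_add, tsub_add_cancel_of_le (Nat.floor_le zero_le)]

variable (Φ : Flow ℝ≥0 X)

/-- The limit of the orbit of a point of `V` along the natural numbers; a junk value where there is
no limit, and for points outside `X`. -/
noncomputable def limitMap (x : V) : V :=
  limUnder atTop fun n : ℕ => timeMap Φ n x

/-- The points of `X` whose orbit converges to an equilibrium, as a subset of `V`. -/
def convergentSet : Set V :=
  {x ∈ X | (∃ c, Tendsto (fun n : ℕ => timeMap Φ n x) atTop (𝓝 c)) ∧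
    limitMap Φ x ∈ ((↑) '' equilibria Φ : Set V)}

variable {Φ}

theorem mem_convergentSet {x e : X} (h : Tendsto (fun t => Φ t x) atTop (𝓝 e)) :
    (x : V) ∈ convergentSet Φ ∧ limitMap Φ x = e := by
  have h1 : Tendsto (fun n : ℕ => timeMap Φ n x) atTop (𝓝 (e : V)) := by
    simp only [timeMap_coe]
    exact (continuous_subtype_val.tendsto e).comp (h.comp tendsto_natCast_atTop_atTop)
  have h2 : limitMap Φ x = e := h1.limUnder_eq
  exact ⟨⟨x.2, ⟨_, h1⟩, h2 ▸ ⟨e, mem_equilibria_of_tendsto h, rfl⟩⟩, h2⟩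

theorem exists_tendsto_of_mem_convergentSet {x : X} (h : (x : V) ∈ convergentSet Φ) :
    ∃ e : X, Tendsto (fun t => Φ t x) atTop (𝓝 e) ∧ limitMap Φ x = e := by
  obtain ⟨-, ⟨c, hc⟩, e, he, hec⟩ := h
  have h1 : limitMap Φ x = c := hc.limUnder_eq
  refine ⟨e, tendsto_flow_of_tendsto_nat he ?_, hec.symm⟩
  rw [h1] at hec
  rw [tendsto_subtype_rng, hec]
  simpa only [timeMap_coe] using hc

/-- The equilibria that are approached by larger equilibria. -/
def accumulationEquilibria [PartialOrder V] (Φ : Flow ℝ≥0 X) : Set X :=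
  {e | e ∈ equilibria Φ ∧ ∃ᶠ u in 𝓝 e, u ∈ equilibria Φ ∧ StronglyLT (e : V) u}

variable [NormedSpace ℝ V]

/-- The points whose orbit converges either to the same equilibrium as that of some larger point on
the line in direction `v`, or to an equilibrium approached by larger equilibria. -/
def goodSet [PartialOrder V] (Φ : Flow ℝ≥0 X) (v : V) : Set V :=
  (convergentSet Φ ∩ limitMap Φ ⁻¹' ((↑) '' accumulationEquilibria Φ)) ∪
    ⋃ q : ℚ, ⋃ _ : 0 < q, {x | x ∈ convergentSet Φ ∧ x + (q : ℝ) • v ∈ convergentSet Φ ∧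
      limitMap Φ (x + (q : ℝ) • v) = limitMap Φ x}

variable [PartialOrder V] [IsOrderedAddMonoid V] [IsOrderedModule ℝ V] [OrderClosedTopology V]
  {t₀ : ℝ≥0} {D : ℝ≥0 → X → V →L[ℝ] V}

/-- On a line in direction `v`, the limit equilibrium of a convergent point is, off a countable set,
accumulated by limits of larger convergent points. These limits are larger equilibria, unless one of
them coincides with it; then order convexity provides a point at rational distance with the same
limit. -/
theorem IsEventuallyStronglyMonotone.countable_line_not_good [SecondCountableTopology V]
    (hΦ : IsEventuallyStronglyMonotone Φ) (hXo : X.OrdConnected)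
    (hB : ∀ x : X, HasPrecompactOrbit Φ x) {v : V} (hv : StronglyLT 0 v) (x₀ : V) :
    {s : ℝ | x₀ + s • v ∈ convergentSet Φ \ goodSet Φ v}.Countable := by
  set T := {s : ℝ | x₀ + s • v ∈ convergentSet Φ \ goodSet Φ v} with hT
  refine Countable.mono ?_ (countable_setOf_right_isolated (fun s => limitMap Φ (x₀ + s • v)) T)
  intro s hs
  refine ⟨hs, ?_⟩
  by_contra! hcon
  obtain ⟨hsC, hsG⟩ := hs
  set x : X := ⟨x₀ + s • v, hsC.1⟩ with hx
  obtain ⟨e, he, hex⟩ := exists_tendsto_of_mem_convergentSet (x := x) hsC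
  have heq := mem_equilibria_of_tendsto he
  obtain ⟨-, t₁, ht₁⟩ := id hΦ
  refine hsG (Or.inl ⟨hsC, e, ⟨heq, ?_⟩, hex.symm⟩)
  rw [Metric.nhds_basis_ball.frequently_iff]
  intro r hr
  have hball : Metric.ball (e : V) r ∈ 𝓝 (limitMap Φ (x₀ + s • v)) := by
    rw [show limitMap Φ (x₀ + s • v) = e from hex]
    exact Metric.ball_mem_nhds _ hr
  obtain ⟨s', hs', hlt, hmem⟩ := hcon _ hball
  obtain ⟨e', he', hey⟩ := exists_tendsto_of_mem_convergentSet (x := ⟨_, hs'.1.1⟩) hs'.1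
  have heq' := mem_equilibria_of_tendsto he'
  have hstep : ∀ {a b : ℝ}, a < b → x₀ + a • v ≤ x₀ + b • v := fun {a b} hab =>
    add_le_add_right (smul_le_smul_of_nonneg_right hab.le hv.le) x₀
  have hle : e ≤ e' := le_of_tendsto_of_tendsto' he he' fun t => hΦ.1 t _ _ (hstep hlt)
  have hne : e ≠ e' := by
    rintro rfl
    obtain ⟨q, hq0, hq⟩ := exists_rat_btwn (sub_pos.2 hlt)
    have hq0' : (0 : ℚ) < q := by exact_mod_cast hq0
    have hz : x₀ + s • v + (q : ℝ) • v = x₀ + (s + q) • v := by rw [add_smul, add_assoc]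
    have hzX : x₀ + (s + q) • v ∈ X :=
      hXo.out hsC.1 hs'.1.1 ⟨hstep (by linarith), hstep (by linarith)⟩
    -- the orbit of the intermediate point is squeezed, but convergence needs precompactness
    have hzlim : Tendsto (fun t => Φ t ⟨_, hzX⟩) atTop (𝓝 e) := by
      refine (hB ⟨_, hzX⟩).tendsto fun a ha => ?_
      obtain ⟨𝒰, h𝒰, hU⟩ := mem_omegaSet_iff.1 ha
      refine le_antisymm ?_ ?_
      · exact le_of_tendsto_of_tendsto' hU (he'.mono_left h𝒰) fun t =>
          hΦ.1 t _ _ (hstep (by linarith))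
      · exact le_of_tendsto_of_tendsto' (he.mono_left h𝒰) hU fun t =>
          hΦ.1 t _ _ (hstep (by linarith))
    obtain ⟨hz1, hz2⟩ := mem_convergentSet hzlim
    refine hsG (Or.inr (mem_iUnion.2 ⟨q, mem_iUnion.2 ⟨hq0', hsC, ?_, ?_⟩⟩))
    · rw [hz]; exact hz1
    · rw [hz]; exact hz2.trans hex.symm
  refine ⟨e', ?_, heq', ?_⟩
  · simpa only [Subtype.dist_eq, Metric.mem_ball, hey] using hmem
  · have := ht₁ e e' (lt_of_le_of_ne hle hne) t₁ le_rfl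
    rwa [mem_equilibria_iff.1 heq, mem_equilibria_iff.1 heq'] at this

variable [Nontrivial V]

theorem IsCompactC1From.goodSet_subset (hD : IsCompactC1From Φ t₀ D)
    (hΦ : IsEventuallyStronglyMonotone Φ) (hXo : X.OrdConnected)
    (hB : ∀ x : X, HasPrecompactOrbit Φ x)
    (hirr : ∀ e ∈ equilibria Φ, IsIrreducibleAt t₀ D e) {v : V} (hv : StronglyLT 0 v) :
    goodSet Φ v ⊆ ((↑) '' stablyConvergent Φ t₀ D : Set V) := by
  have hmem : ∀ x : V, x ∈ goodSet Φ v → x ∈ X := by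
    rintro x (hx | hx)
    · exact hx.1.1
    · simp only [mem_iUnion] at hx
      obtain ⟨q, -, hx⟩ := hx
      exact hx.1.1
  intro x hx
  lift x to X using hmem x hx
  refine ⟨x, ?_, rfl⟩
  rcases hx with ⟨hx, hxa⟩ | hx
  · obtain ⟨e, he, hex⟩ := exists_tendsto_of_mem_convergentSet hx
    obtain ⟨e', he', hee⟩ := hxa
    obtain rfl : e' = e := Subtype.ext (hee.trans hex)
    exact ⟨e', hD.mem_stableEquilibria_of_accumulation hΦ.1 hXo hirr he'.1 he'.2,
      omegaSet_eq_singleton he⟩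
  · simp only [mem_iUnion] at hx
    obtain ⟨q, hq, hx, hy, hxy⟩ := hx
    obtain ⟨e, he, hex⟩ := exists_tendsto_of_mem_convergentSet hx
    obtain ⟨e', he', hey⟩ :=
      exists_tendsto_of_mem_convergentSet (x := ⟨(x : V) + (q : ℝ) • v, hy.1⟩) hy
    obtain rfl : e' = e := Subtype.ext (hey.symm.trans (hxy.trans hex))
    have hlt : x < ⟨(x : V) + (q : ℝ) • v, hy.1⟩ := by
      rw [← Subtype.coe_lt_coe]
      exact lt_add_of_pos_right _ (hv.smul (c := (q : ℝ)) (by exact_mod_cast hq)).lt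
    exact ⟨e', hD.mem_stableEquilibria_of_tendsto hΦ hXo hB hirr hv hlt he he',
      omegaSet_eq_singleton he⟩

/-- Choose a limit point `p s` of each nonconvergent point `x s` of the line. Off a countable set,
`p s` is accumulated by points `p s'` with `s < s'`, which lie above all of `ω(x s)`; so `p s` would
be the largest element of the unordered set `ω(x s)`. -/
theorem IsCompactC1From.countable_line_not_convergent [CompleteSpace V] [SecondCountableTopology V]
    (hD : IsCompactC1From Φ t₀ D)
    (hΦ : IsEventuallyStronglyMonotone Φ) (hXo : X.OrdConnected)
    (hB : ∀ x : X, HasPrecompactOrbit Φ x)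
    (hirr : ∀ e ∈ equilibria Φ, IsIrreducibleAt t₀ D e) {v : V} (hv : StronglyLT 0 v) (x₀ : V) :
    {s : ℝ | x₀ + s • v ∈ X \ convergentSet Φ}.Countable := by
  set T := {s : ℝ | x₀ + s • v ∈ X \ convergentSet Φ} with hT
  have hp : ∀ s : ℝ, ∃ p : V, ∀ hs : x₀ + s • v ∈ X, p ∈ ((↑) '' omegaSet Φ ⟨_, hs⟩ : Set V) := by
    intro s
    by_cases hs : x₀ + s • v ∈ X
    · obtain ⟨a, ha⟩ := (hB ⟨_, hs⟩).omegaSet_nonempty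
      exact ⟨a, fun _ => ⟨a, ha, rfl⟩⟩
    · exact ⟨0, fun h => absurd h hs⟩
  choose p hp using hp
  refine Countable.mono ?_ (countable_setOf_right_isolated p T)
  intro s hs
  refine ⟨hs, ?_⟩
  by_contra! hcon
  obtain ⟨hsX, hsC⟩ := hs
  set x : X := ⟨x₀ + s • v, hsX⟩ with hx
  have hnc : ¬ ∃ q, Tendsto (fun t => Φ t x) atTop (𝓝 q) := fun ⟨q, hq⟩ =>
    hsC (mem_convergentSet hq).1
  obtain ⟨b, hb, hbp⟩ := hp s hsX
  have hle : ∀ a ∈ omegaSet Φ x, a ≤ b := by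
    intro a ha
    by_contra hab
    have hnhds : (Ici (a : V))ᶜ ∈ 𝓝 (p s) := by
      refine isClosed_Ici.isOpen_compl.mem_nhds fun hmem => hab ?_
      rw [← hbp] at hmem
      exact hmem
    obtain ⟨s', hs', hlt, hps'⟩ := hcon _ hnhds
    obtain ⟨b', hb', hbp'⟩ := hp s' hs'.1
    have hxy : x < (⟨x₀ + s' • v, hs'.1⟩ : X) := by
      rw [← Subtype.coe_lt_coe]
      refine add_lt_add_right (sub_pos.1 ?_) x₀
      rw [← sub_smul]
      exact (hv.smul (sub_pos.2 hlt)).lt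
    have := hD.omegaSet_le_of_not_convergent hΦ hXo hB hirr hv hxy hnc a ha b' hb'
    exact hps' (hbp' ▸ this)
  have hsing : ∀ a ∈ omegaSet Φ x, a = b := by
    intro a ha
    by_contra hne
    exact hΦ.not_lt_of_mem_omegaSet ha hb (lt_of_le_of_ne (hle a ha) hne)
  exact hnc ⟨b, (hB x).tendsto hsing⟩

end GoodPoints

/-! ### Measurability -/

section Measurability

variable {V : Type*} [NormedAddCommGroup V] [MeasurableSpace V] [BorelSpace V] {X : Set V}
  {Φ : Flow ℝ≥0 X}

theorem measurable_timeMap (hX : MeasurableSet X) (t : ℝ≥0) :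
    Measurable (timeMap Φ t) := by
  refine (MeasurableEmbedding.subtype_coe hX).measurable_extend ?_ measurable_zero
  exact measurable_subtype_coe.comp (Φ.continuous continuous_const continuous_id).measurable

/-- The set is a countable intersection of open sets within the closed set of equilibria. -/
theorem measurableSet_accumulationEquilibria [PartialOrder V] :
    MeasurableSet (accumulationEquilibria Φ) := by
  have : accumulationEquilibria Φ = equilibria Φ ∩ ⋂ n : ℕ,
      ⋃ u ∈ equilibria Φ, {e | StronglyLT (e : V) u} ∩ Metric.ball u (1 / ((n : ℝ) + 1)) := by
    ext e
    simp only [accumulationEquilibria, Metric.nhds_basis_ball_inv_nat_succ.frequently_iff,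
      mem_inter_iff, mem_iInter, mem_iUnion, Metric.mem_ball, mem_ofPred_eq, true_imp_iff]
    refine and_congr_right fun _ => forall_congr' fun n => exists_congr fun u => ?_
    rw [dist_comm]
    tauto
  rw [this]
  refine isClosed_equilibria.measurableSet.inter (MeasurableSet.iInter fun n => IsOpen.measurableSet
    (isOpen_biUnion fun u _ => IsOpen.inter ?_ Metric.isOpen_ball))
  exact isOpen_setOf_stronglyLT.preimage
    (by fun_prop : Continuous fun e : X => ((e : V), (u : V)))

theorem measurable_limitMap [CompleteSpace V] [SecondCountableTopology V] (hX : MeasurableSet X) :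
    Measurable (limitMap Φ) :=
  (StronglyMeasurable.limUnder (l := atTop) fun n : ℕ =>
    (measurable_timeMap (Φ := Φ) hX n).stronglyMeasurable).measurable

theorem measurableSet_convergentSet [CompleteSpace V] [SecondCountableTopology V]
    (hX : MeasurableSet X) : MeasurableSet (convergentSet Φ) :=
  hX.inter ((measurableSet_exists_tendsto fun n : ℕ => measurable_timeMap (Φ := Φ) hX n).inter
    (measurable_limitMap hX (hX.subtype_image isClosed_equilibria.measurableSet)))

theorem measurableSet_goodSet [NormedSpace ℝ V] [CompleteSpace V] [SecondCountableTopology V]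
    [PartialOrder V] (hX : MeasurableSet X) (v : V) : MeasurableSet (goodSet Φ v) := by
  have hC := measurableSet_convergentSet (Φ := Φ) hX
  have hL := measurable_limitMap (Φ := Φ) hX
  refine (hC.inter (hL (hX.subtype_image measurableSet_accumulationEquilibria))).union
    (MeasurableSet.iUnion fun q => MeasurableSet.iUnion fun _ => ?_)
  have hshift : Measurable fun x : V => x + (q : ℝ) • v :=
    (by fun_prop : Continuous fun x : V => x + (q : ℝ) • v).measurable
  exact hC.inter ((hshift hC).inter (measurableSet_eq_fun (hL.comp hshift) hL))

end Measurability

/-- On the trivial space the interior of the cone contains only `0`, so no line is available; but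
all derivatives vanish, and every point is a linearly stable equilibrium. -/
theorem stablyConvergent_eq_univ_of_subsingleton {V : Type*} [NormedAddCommGroup V]
    [NormedSpace ℝ V] [Subsingleton V] {X : Set V} (Φ : Flow ℝ≥0 X) (t₀ : ℝ≥0)
    (D : ℝ≥0 → X → V →L[ℝ] V) : stablyConvergent Φ t₀ D = univ := by
  refine eq_univ_of_forall fun x => ⟨x, ⟨?_, Or.inl fun t _ _ => ?_⟩, ?_⟩
  · exact mem_equilibria_iff.2 fun t => Subsingleton.elim _ _
  · have h : specRadius (D t x) ≤ ENNReal.ofReal 2⁻¹ :=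
      specRadius_le_of_norm_pow_le one_pos (by norm_num) fun n => by
        rw [Subsingleton.elim (D t x ^ n) 0, norm_zero]
        positivity
    refine h.trans_lt ?_
    rw [← ENNReal.ofReal_one]
    exact (ENNReal.ofReal_lt_ofReal_iff one_pos).2 (by norm_num)
  · exact omegaSet_eq_singleton (tendsto_const_nhds.congr fun t => Subsingleton.elim _ _)

end MonotoneSemiflow

theorem mainTheorem4
    {V : Type*} [NormedAddCommGroup V] [NormedSpace ℝ V] [CompleteSpace V]
    [TopologicalSpace.SeparableSpace V] [MeasurableSpace V] [BorelSpace V]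
    [PartialOrder V] [IsOrderedAddMonoid V] [IsOrderedModule ℝ V] [OrderClosedTopology V]
    (hcone : (interior (Set.Ici (0 : V))).Nonempty)
    (X : Set V) (hX : MeasurableSet X) (hXp : IsPConvex X)
    (Φ : Flow ℝ≥0 X) (hsop : IsSOP Φ)
    (t₀ : ℝ≥0) (D : ℝ≥0 → X → V →L[ℝ] V) (hsmooth : IsCompactC1From Φ t₀ D)
    (hB : ∀ x : X, HasPrecompactOrbit Φ x)
    (hXo : X.OrdConnected)
    (hirr : ∀ e ∈ equilibria Φ, IsIrreducibleAt t₀ D e)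
    (hesm : IsEventuallyStronglyMonotone Φ) :
    IsPrevalentIn ((↑) '' stablyConvergent Φ t₀ D : Set V) X := by
  rcases subsingleton_or_nontrivial V with hV | hV
  · refine isShy_of_countable_lines (S := ∅) ?_ MeasurableSet.empty 0 fun x => by simp
    rw [stablyConvergent_eq_univ_of_subsingleton]
    simp
  have : SecondCountableTopology V := UniformSpace.secondCountable_of_separable V
  -- the direction of the test measure
  obtain ⟨v, hv⟩ := hcone
  replace hv : StronglyLT 0 v := by simpa [StronglyLT] using hv
  refine isShy_of_countable_lines (S := X \ goodSet Φ v)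
    (sdiff_subset_sdiff_right (hsmooth.goodSet_subset hesm hXo hB hirr hv))
    (hX.diff (measurableSet_goodSet hX v)) v fun x₀ => ?_
  refine ((hsmooth.countable_line_not_convergent hesm hXo hB hirr hv x₀).union
    (hesm.countable_line_not_good hXo hB hv x₀)).mono fun s hs => ?_
  by_cases hC : x₀ + s • v ∈ convergentSet Φ
  · exact Or.inr ⟨hC, hs.2⟩
  · exact Or.inl ⟨hs.1, hC⟩
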